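/- **Setting.** Let $K=2^r$ with $r\ge 1$, let $\omega>0$, and let $a_1,b_1,\dots,a_K,b_K\in\mathbb R$ with $b_t-a_t=\omega$ for all $t$ (the intervals may overlap). Let $\mathbf S\subseteq\{1,\dots,d\}$ be a nonempty set of $S$ strong features; the coefficients $\beta_j$, $j\in\mathbf S$, are independent standard normal and $\beta_j=0$ for $j\notin\mathbf S$; put $f(x)=x^{T}\beta$. For every sample size $n$ the indices $1,\dots,n$ are partitioned into clusters $\mathbb S_1,\dots,\mathbb S_K$ of sizes $n_1,\dots,n_K$; the training covariates are independent, $x_i$ uniform on $[a_t,b_t]^d$ for $i\in\mathbb S_t$, and $Y_i=f(x_i)+\varepsilon_i$ with i.i.d. errors of mean $0$ and finite variance. The test point $x_\star$ has a label $B$, uniform on $\{1,\dots,K\}$, and given $B=t$ it is uniform on $[a_t,b_t]^d$. Coefficients, training covariates, errors and $(B,x_\star)$ are independent. **Forests.** Let $k_n>2$ and let $(p_{nj})_{j\le d}$ be probabilities with $\sum_jp_{nj}=1$; put $p_n=\min_{j\in\mathbf S}p_{nj}$. A random tree $\theta$ cuts a cube $\lceil\log_2k_n\rceil$ times in succession;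 at each node, independently, coordinate $j$ is chosen with probability $p_{nj}$ and the current box is halved at the midpoint of its $j$-th side. For a test point with label $B=t$ let $A_n(x_\star,\theta)$ be the cell containing $x_\star$ of the partition of $[a_t,b_t]^d$ so obtained. A tree trained on a set $I$ of indices predicts the average of the $Y_i$ with $i\in I$ and $x_i\in A_n(x_\star,\theta)$, and $0$ if there are none; a forest predicts the expectation of this over $\theta$. The *Ensemble* uses, for a test point with label $t$, only the forest trained on $I=\mathbb S_t$; the *Merged* forest uses $I=\{1,\dots,n\}$. Either prediction has the form $\hat Y(x_\star)=\sum_iY_iw_i$, with weights $w_i$ depending on the covariates only. Its squared bias is $\mathbb E\big[(\mathbb E[\hat Y(x_\star)\mid x_\star,B,\beta]-f(x_\star))^2\big]$, and the leading term of the squared bias is $$\sum_{i\ne i'}\mathbb E\big[w_i\,(f(x_i)-f(x_\star))\,w_{i'}\,(f(x_{i'})-f(x_\star))\big].$$ **Theorem 5.** The expectations above exist. For every $n$: 1. the leading term of the squared bias of the Ensemble is at most $\frac K4\,\omega^2\,S\,k_n^{\log_2(1-3p_n/4)}$; 2. the leading term of the squared bias of the Merged forest is at most $4^{\log_2K-1}\,\omega^2\,S\,k_n^{\log_2(1-3p_n/4)}$.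 For either learner and every $n$, the squared bias itself is at most the same bound plus $\mathbb E[f(x_\star)^2\,\mathbf 1_{E}]$, where $E$ is the event that $A_n(x_\star,\theta)$ contains none of the training points that the learner uses for $x_\star$. If $n_t/n\to1/K$ for every $t$ and $k_n\log k_n/n\to0$, then for all large $n$ the squared biases themselves satisfy the bounds in 1 and 2. The bound for the Merged forest is strictly larger than the one for the Ensemble; their ratio is $4^{\log_2K}/K=K=2^r$, which is exponential in $r=\log_2K$. -/

import Mathlib

open MeasureTheory ProbabilityTheory Filter Topology
open scoped ENNReal

noncomputable section

namespace CenteredForest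

/-! ### Random trees with midpoint splits -/

/-- A complete binary tree of depth `L` whose internal nodes carry the index of the coordinate
that is split there: a root coordinate, the tree on the lower half, the tree on the upper half. -/
def SplitTree (d : ℕ) : ℕ → Type
  | 0 => Unit
  | L + 1 => Fin d × SplitTree d L × SplitTree d L

instance instFintypeSplitTree (d : ℕ) : (L : ℕ) → Fintype (SplitTree d L)
  | 0 => inferInstanceAs (Fintype Unit)
  | L + 1 =>
    haveI := instFintypeSplitTree d L
    inferInstanceAs (Fintype (Fin d × SplitTree d L × SplitTree d L))

/-- The probability of a tree when, independently at every internal node, coordinate `j` is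
selected with probability `q j`. -/
def treeProb {d : ℕ} (q : Fin d → ℝ) : (L : ℕ) → SplitTree d L → ℝ
  | 0, _ => 1
  | L + 1, (j, l, u) => q j * treeProb q L l * treeProb q L u

/-- The expectation over the randomness of the tree. -/
def treeExp {d : ℕ} (q : Fin d → ℝ) (L : ℕ) (g : SplitTree d L → ℝ) : ℝ :=
  ∑ θ : SplitTree d L, treeProb q L θ * g θ

/-- An axis-parallel box, given by its lower and its upper corner. -/
abbrev Box (d : ℕ) : Type := (Fin d → ℝ) × (Fin d → ℝ)

/-- The cube `[a, b)^d`. -/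
def cube (d : ℕ) (a b : ℝ) : Box d := (fun _ => a, fun _ => b)

/-- Membership in the half-open box. -/
def Box.Contains {d : ℕ} (R : Box d) (x : Fin d → ℝ) : Prop :=
  ∀ j, R.1 j ≤ x j ∧ x j < R.2 j

open Classical in
/-- The cell containing `x` of the partition of the root box `R` that is generated by the tree:
every node halves the current box at the midpoint of the selected side. -/
def leafBox {d : ℕ} : (L : ℕ) → SplitTree d L → Box d → (Fin d → ℝ) → Box d
  | 0, _, R, _ => R
  | L + 1, (j, l, u), R, x =>
    if x j < (R.1 j + R.2 j) / 2 then
      leafBox L l (R.1, Function.update R.2 j ((R.1 j + R.2 j) / 2)) x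
    else
      leafBox L u (Function.update R.1 j ((R.1 j + R.2 j) / 2), R.2) x

/-! ### Forests as weighted averages of the training outcomes -/

open Classical in
/-- The number of training points with index in `I` that share the cell of `x`. -/
def leafCount {d n : ℕ} (L : ℕ) (θ : SplitTree d L) (R : Box d) (I : Finset (Fin n))
    (X : Fin n → Fin d → ℝ) (x : Fin d → ℝ) : ℕ :=
  (I.filter fun i => (leafBox L θ R x).Contains (X i)).card

open Classical in
/-- The weight that the tree `θ`, grown on the root box `R` and trained on the points with index
in `I`, gives to the `i`-th outcome when it predicts at `x`. All weights vanish if the cell of `x`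
contains no training point. -/
def treeWeight {d n : ℕ} (L : ℕ) (θ : SplitTree d L) (R : Box d) (I : Finset (Fin n))
    (X : Fin n → Fin d → ℝ) (x : Fin d → ℝ) (i : Fin n) : ℝ :=
  if i ∈ I ∧ (leafBox L θ R x).Contains (X i) then ((leafCount L θ R I X x : ℕ) : ℝ)⁻¹ else 0

/-- The weight of the `i`-th outcome in the forest: the expectation over the random tree. -/
def forestWeight {d n : ℕ} (q : Fin d → ℝ) (L : ℕ) (R : Box d) (I : Finset (Fin n))
    (X : Fin n → Fin d → ℝ) (x : Fin d → ℝ) (i : Fin n) : ℝ :=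
  treeExp q L fun θ => treeWeight L θ R I X x i

/-- The probability, over the random tree, that the cell of `x` contains no training point. -/
def emptyProb {d n : ℕ} (q : Fin d → ℝ) (L : ℕ) (R : Box d) (I : Finset (Fin n))
    (X : Fin n → Fin d → ℝ) (x : Fin d → ℝ) : ℝ :=
  treeExp q L fun θ => if leafCount L θ R I X x = 0 then 1 else 0

/-- The number of successive splits for the parameter `k`, namely `⌈log₂ k⌉`. -/
def depth (k : ℝ) : ℕ := ⌈Real.logb 2 k⌉₊

/-- The indices of the training points in cluster `t`, for the cluster assignment `c`. -/
def cluster {n K : ℕ} (c : Fin n → Fin K) (t : Fin K) : Finset (Fin n) :=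
  Finset.univ.filter fun i => c i = t

/-- A linear learner: the weights of the training outcomes as a function of the cluster label of
the test point, the test point, and the training covariates. -/
abbrev Learner (d K n : ℕ) : Type :=
  Fin K → (Fin d → ℝ) → (Fin n → Fin d → ℝ) → Fin n → ℝ

/-- The Ensemble: the forest of cluster `t` partitions `[a t, b t]^d`, is trained on cluster `t`
only, and enters with weight `1` on test points from cluster `t` and with weight `0` otherwise. -/
def ensemble {d K n : ℕ} (a b : Fin K → ℝ) (c : Fin n → Fin K) (q : Fin d → ℝ) (k : ℝ) :
    Learner d K n := fun B x X i =>
  ∑ t, (if B = t then 1 else 0) *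
    forestWeight q (depth k) (cube d (a t) (b t)) (cluster c t) X x i

/-- The probability that the Ensemble finds no training point to average over. -/
def ensembleEmptyProb {d K n : ℕ} (a b : Fin K → ℝ) (c : Fin n → Fin K) (q : Fin d → ℝ) (k : ℝ)
    (B : Fin K) (x : Fin d → ℝ) (X : Fin n → Fin d → ℝ) : ℝ :=
  ∑ t, (if B = t then 1 else 0) *
    emptyProb q (depth k) (cube d (a t) (b t)) (cluster c t) X x

/-- The Merged forest: the outcomes of all training points, of whatever cluster, that fall into
the cell of the test point are averaged. The sides of that cell are
`[F⁻¹(s), F⁻¹(s + 2^{-m})]`, where `F` is the distribution function of the coordinates of the test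
point given its label `B` (uniform on `[a B, b B]`) and `s` is the truncation to `m` binary digits
of the value of `F` at that coordinate, `m` being the number of splits of that coordinate. -/
def merged {d K n : ℕ} (a b : Fin K → ℝ) (q : Fin d → ℝ) (k : ℝ) :
    Learner d K n := fun B x X i =>
  forestWeight q (depth k) (cube d (a B) (b B)) Finset.univ X x i

/-- The probability that the Merged forest finds no training point to average over. -/
def mergedEmptyProb {d K n : ℕ} (a b : Fin K → ℝ) (q : Fin d → ℝ) (k : ℝ)
    (B : Fin K) (x : Fin d → ℝ) (X : Fin n → Fin d → ℝ) : ℝ :=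
  emptyProb q (depth k) (cube d (a B) (b B)) Finset.univ X x

/-! ### The data-generating model -/

/-- The uniform distribution on `[a, b]^d`. -/
def uniformCube (d : ℕ) (a b : ℝ) : Measure (Fin d → ℝ) :=
  Measure.pi fun _ => ProbabilityTheory.cond volume (Set.Icc a b)

/-- The training covariates: independent, the `i`-th uniform on the cube of its cluster. -/
def trainLaw (d : ℕ) {n K : ℕ} (a b : Fin K → ℝ) (c : Fin n → Fin K) :
    Measure (Fin n → Fin d → ℝ) :=
  Measure.pi fun i => uniformCube d (a (c i)) (b (c i))

/-- The test point with its label: the label `B` is uniform on the clusters and, given `B`, the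
test point is uniform on the cube of cluster `B`. -/
def testLaw (d : ℕ) {K : ℕ} (a b : Fin K → ℝ) : Measure (Fin K × (Fin d → ℝ)) :=
  ∑ t, (K : ℝ≥0∞)⁻¹ • (uniformCube d (a t) (b t)).map (Prod.mk t)

open Classical in
/-- The coefficients: independent standard normal on the set `S` of strong features, and zero
off `S`. -/
def betaLaw {d : ℕ} (S : Finset (Fin d)) : Measure (Fin d → ℝ) :=
  Measure.pi fun j => if j ∈ S then gaussianReal 0 1 else Measure.dirac 0

/-- The noise: `n` independent errors with common law `ν`. -/
def noiseLaw (n : ℕ) (ν : Measure ℝ) : Measure (Fin n → ℝ) :=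
  Measure.pi fun _ => ν

/-- The linear regression function. -/
def regr {d : ℕ} (β x : Fin d → ℝ) : ℝ := ∑ j, x j * β j

/-! ### Squared bias -/

/-- The prediction of a learner at the test point, from the outcomes `Y i = regr β (X i) + ε i`. -/
def prediction {d K n : ℕ} (W : Learner d K n) (β : Fin d → ℝ) (B : Fin K) (x : Fin d → ℝ)
    (X : Fin n → Fin d → ℝ) (ε : Fin n → ℝ) : ℝ :=
  ∑ i, (regr β (X i) + ε i) * W B x X i

/-- The squared error of the mean prediction, the mean being over the training covariates and the
noise, at given coefficients and test point. -/
def sqBiasAt {d K n : ℕ} (W : Learner d K n) (a b : Fin K → ℝ) (c : Fin n → Fin K)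
    (ν : Measure ℝ) (z : (Fin d → ℝ) × (Fin K × (Fin d → ℝ))) : ℝ :=
  ((∫ y, prediction W z.1 z.2.1 z.2.2 y.1 y.2 ∂((trainLaw d a b c).prod (noiseLaw n ν)))
    - regr z.1 z.2.2) ^ 2

/-- The squared bias, averaged over the coefficients and the test point. -/
def sqBias {d K n : ℕ} (W : Learner d K n) (S : Finset (Fin d)) (a b : Fin K → ℝ)
    (c : Fin n → Fin K) (ν : Measure ℝ) : ℝ :=
  ∫ z, sqBiasAt W a b c ν z ∂((betaLaw S).prod (testLaw d a b))

/-- `∑_{i ≠ i'} W_i (f(x_i) - f(x)) W_{i'} (f(x_{i'}) - f(x))`. -/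
def crossTerm {d K n : ℕ} (W : Learner d K n)
    (z : ((Fin d → ℝ) × (Fin K × (Fin d → ℝ))) × (Fin n → Fin d → ℝ)) : ℝ :=
  ∑ i, ∑ i' ∈ Finset.univ.erase i,
    (W z.1.2.1 z.1.2.2 z.2 i * (regr z.1.1 (z.2 i) - regr z.1.1 z.1.2.2)) *
    (W z.1.2.1 z.1.2.2 z.2 i' * (regr z.1.1 (z.2 i') - regr z.1.1 z.1.2.2))

/-- The leading term of the squared bias: the expectation of the sum over the `n (n - 1)` ordered
pairs of distinct training points. -/
def leadingTerm {d K n : ℕ} (W : Learner d K n) (S : Finset (Fin d)) (a b : Fin K → ℝ)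
    (c : Fin n → Fin K) : ℝ :=
  ∫ z, crossTerm W z ∂(((betaLaw S).prod (testLaw d a b)).prod (trainLaw d a b c))

/-- `E[f(x)² P(no training point in the cell of x)]`: the part of the mean squared error that is
due to predicting `0` on cells without training points. -/
def emptyTerm {d K n : ℕ} (e : Fin K → (Fin d → ℝ) → (Fin n → Fin d → ℝ) → ℝ)
    (S : Finset (Fin d)) (a b : Fin K → ℝ) (c : Fin n → Fin K) : ℝ :=
  ∫ z, regr z.1.1 z.1.2.2 ^ 2 * e z.1.2.1 z.1.2.2 z.2
    ∂(((betaLaw S).prod (testLaw d a b)).prod (trainLaw d a b c))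

/-- The rate `k ^ log₂ (1 - 3 p / 4)`. -/
def rate (k p : ℝ) : ℝ := k ^ Real.logb 2 (1 - 3 * p / 4)

/-- The bound for the Ensemble, with `s` strong features. -/
def ensembleBound (K s : ℕ) (ω k p : ℝ) : ℝ :=
  (K : ℝ) / 4 * ω ^ 2 * s * rate k p

/-- The bound for the Merged forest, with `s` strong features. -/
def mergedBound (K s : ℕ) (ω k p : ℝ) : ℝ :=
  (4 : ℝ) ^ (Real.logb 2 K - 1) * ω ^ 2 * s * rate k p

end CenteredForest

end

/-!
Both learners are forests whose set `I B` of admissible training points depends on the label `B` of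
the test point, and one estimate serves every choice of `I`.

The regression function is linear with independent, centered coefficients of variance one on `S`.
Hence the mean over the coefficients of the square of a linear form `∑ j, β j * v j` is
`∑ j ∈ S, v j ^ 2` (`integral_betaLaw_sq`), and everything reduces to single coordinates. Adding the
diagonal turns the cross terms into the square of `∑ i, W i * (f (X i) - f x)`; the squared bias is,
by Jensen's inequality over the training covariates, at most the mean of the square of that sum minus
`f x` times the probability of an empty cell. Jensen's inequality over the tree then leaves, for each
tree, the squared distance from `x j` to the average of the `j`-th coordinates in the cell, and, for
the squared bias, the square of `x j` on empty cells. The two never occur for the same tree, so that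
they add up without a cross term (`forestDev_sub_sq_le`).

The average in the cell depends on the cell of the test point only, not on the position of the test
point in that cell. As the test point is uniform on its cell, the mean squared distance is at most
a third of the squared side, whatever the training points are (`lintegral_treeDev_sq_le`). The number
of splits of coordinate `j` on the path to a given point is binomial, so that the expected squared
side is `ω ^ 2 * (1 - 3 * q j / 4) ^ L` (`treeExp_side_sq`). Together the bound is
`ω ^ 2 * S.card * rate / 3`.

Since `K ≥ 2`, the claimed constants `K / 4` and `K ^ 2 / 4` are at least `1 / 2`. The difference to
`1 / 3` absorbs the contribution of empty cells in large samples: a cell is empty with probability at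
most `exp (-n_t / (2 * k))`, which for `k * log k = o(n)` is eventually below every power of `k`,
while the rate is at least `k ^ (-2)` (`eventually_pow_card_le`, `inv_sq_le_rate`).
-/

namespace CenteredForest

/-! ### The random tree -/

/-- The tree of depth `0`. Its cell is the root box itself, so the weights of a tree of any depth are
those of this one grown on the cell of the test point. -/
def rootOnly (d : ℕ) : SplitTree d 0 := ()

theorem treeExp_zero {d : ℕ} (q : Fin d → ℝ) (g : SplitTree d 0 → ℝ) :
    treeExp q 0 g = g (rootOnly d) := by
  change ∑ θ : Unit, 1 * g θ = g (rootOnly d)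
  simp only [one_mul]
  exact Fintype.sum_unique (fun θ : Unit => g θ)

/-- The root coordinate and the two subtrees are independent. -/
theorem treeExp_succ {d : ℕ} (q : Fin d → ℝ) (L : ℕ) (g : SplitTree d (L + 1) → ℝ) :
    treeExp q (L + 1) g =
      ∑ j, q j * treeExp q L fun l => treeExp q L fun u => g (j, l, u) := by
  change ∑ θ : Fin d × SplitTree d L × SplitTree d L, treeProb q (L + 1) θ * g θ = _
  simp only [Fintype.sum_prod_type, treeExp, Finset.mul_sum, treeProb]
  refine Finset.sum_congr rfl fun j _ => Finset.sum_congr rfl fun l _ =>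
    Finset.sum_congr rfl fun u _ => by ring

theorem treeProb_nonneg {d : ℕ} {q : Fin d → ℝ} (hq : ∀ j, 0 ≤ q j) :
    ∀ (L : ℕ) (θ : SplitTree d L), 0 ≤ treeProb q L θ
  | 0, _ => zero_le_one
  | L + 1, (j, l, u) =>
    mul_nonneg (mul_nonneg (hq j) (treeProb_nonneg hq L l)) (treeProb_nonneg hq L u)

theorem treeExp_const {d : ℕ} {q : Fin d → ℝ} (hq : ∑ j, q j = 1) (L : ℕ) (r : ℝ) :
    treeExp q L (fun _ => r) = r := by
  induction L with
  | zero => rw [treeExp_zero]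
  | succ L ih => simp only [treeExp_succ, ih, ← Finset.sum_mul, hq, one_mul]

theorem treeExp_mono {d : ℕ} {q : Fin d → ℝ} (hq : ∀ j, 0 ≤ q j) {L : ℕ}
    {g h : SplitTree d L → ℝ} (hgh : ∀ θ, g θ ≤ h θ) : treeExp q L g ≤ treeExp q L h :=
  Finset.sum_le_sum fun θ _ => mul_le_mul_of_nonneg_left (hgh θ) (treeProb_nonneg hq L θ)

theorem treeExp_nonneg {d : ℕ} {q : Fin d → ℝ} (hq : ∀ j, 0 ≤ q j) {L : ℕ}
    {g : SplitTree d L → ℝ} (hg : ∀ θ, 0 ≤ g θ) : 0 ≤ treeExp q L g :=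
  Finset.sum_nonneg fun θ _ => mul_nonneg (treeProb_nonneg hq L θ) (hg θ)

theorem treeExp_add {d : ℕ} (q : Fin d → ℝ) (L : ℕ) (g h : SplitTree d L → ℝ) :
    treeExp q L (fun θ => g θ + h θ) = treeExp q L g + treeExp q L h := by
  simp [treeExp, mul_add, Finset.sum_add_distrib]

theorem treeExp_sub {d : ℕ} (q : Fin d → ℝ) (L : ℕ) (g h : SplitTree d L → ℝ) :
    treeExp q L (fun θ => g θ - h θ) = treeExp q L g - treeExp q L h := by
  simp [treeExp, mul_sub, Finset.sum_sub_distrib]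

theorem treeExp_mul_const {d : ℕ} (q : Fin d → ℝ) (L : ℕ) (g : SplitTree d L → ℝ) (r : ℝ) :
    treeExp q L (fun θ => g θ * r) = treeExp q L g * r := by
  simp [treeExp, Finset.sum_mul, mul_assoc]

theorem treeExp_finset_sum {d : ℕ} {ι : Type*} (q : Fin d → ℝ) (L : ℕ) (s : Finset ι)
    (g : ι → SplitTree d L → ℝ) :
    treeExp q L (fun θ => ∑ i ∈ s, g i θ) = ∑ i ∈ s, treeExp q L (g i) := by
  simp only [treeExp, Finset.mul_sum]
  exact Finset.sum_comm

theorem treeProb_sum {d : ℕ} {q : Fin d → ℝ} (hq : ∑ j, q j = 1) (L : ℕ) :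
    ∑ θ : SplitTree d L, treeProb q L θ = 1 := by
  simpa [treeExp] using treeExp_const hq L 1

/-- Jensen's inequality for the random tree. -/
theorem treeExp_sq_le {d : ℕ} {q : Fin d → ℝ} (hq0 : ∀ j, 0 ≤ q j) (hq1 : ∑ j, q j = 1)
    (L : ℕ) (g : SplitTree d L → ℝ) :
    treeExp q L g ^ 2 ≤ treeExp q L fun θ => g θ ^ 2 := by
  simpa [treeExp] using (even_two.convexOn_pow (𝕜 := ℝ)).map_sum_le (t := Finset.univ)
    (w := treeProb q L) (p := g) (fun θ _ => treeProb_nonneg hq0 L θ) (treeProb_sum hq1 L)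
    (fun _ _ => Set.mem_univ _)

/-! ### Cells -/

/-- The length of the `j`-th side of a box. -/
def Box.side {d : ℕ} (R : Box d) (j : Fin d) : ℝ := R.2 j - R.1 j

/-- The lower of the two boxes obtained by halving the `j`-th side. -/
noncomputable def Box.lower {d : ℕ} (R : Box d) (j : Fin d) : Box d :=
  (R.1, Function.update R.2 j ((R.1 j + R.2 j) / 2))

/-- The upper of the two boxes obtained by halving the `j`-th side. -/
noncomputable def Box.upper {d : ℕ} (R : Box d) (j : Fin d) : Box d :=
  (Function.update R.1 j ((R.1 j + R.2 j) / 2), R.2)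

/-- The box is a sub-box of the cube `[a, b)^d`; degenerate sides are allowed. -/
structure Box.Within {d : ℕ} (R : Box d) (a b : ℝ) : Prop where
  left : ∀ j, a ≤ R.1 j
  le : ∀ j, R.1 j ≤ R.2 j
  right : ∀ j, R.2 j ≤ b

theorem Box.Within.lower {d : ℕ} {R : Box d} {a b : ℝ} (h : R.Within a b) (j : Fin d) :
    (R.lower j).Within a b := by
  obtain ⟨h1, h2, h3⟩ := h
  refine ⟨fun i => h1 i, fun i => ?_, fun i => ?_⟩ <;>
    rcases eq_or_ne i j with rfl | hi <;> simp [Box.lower, *] <;>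
    linarith [h1 i, h2 i, h3 i]

theorem Box.Within.upper {d : ℕ} {R : Box d} {a b : ℝ} (h : R.Within a b) (j : Fin d) :
    (R.upper j).Within a b := by
  obtain ⟨h1, h2, h3⟩ := h
  refine ⟨fun i => ?_, fun i => ?_, fun i => h3 i⟩ <;>
    rcases eq_or_ne i j with rfl | hi <;> simp [Box.upper, *] <;>
    linarith [h1 i, h2 i, h3 i]

theorem Box.contains_lower_iff {d : ℕ} {R : Box d} {j : Fin d} (hR : R.1 j ≤ R.2 j)
    {x : Fin d → ℝ} :
    (R.lower j).Contains x ↔ R.Contains x ∧ x j < (R.1 j + R.2 j) / 2 := by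
  simp only [Box.Contains, Box.lower]
  constructor
  · intro h
    have hj := h j
    simp only [Function.update_self] at hj
    refine ⟨fun i => ⟨(h i).1, ?_⟩, hj.2⟩
    rcases eq_or_ne i j with rfl | hi
    · linarith [hj.2]
    · simpa [hi] using (h i).2
  · rintro ⟨h, hj⟩ i
    refine ⟨(h i).1, ?_⟩
    rcases eq_or_ne i j with rfl | hi
    · simpa using hj
    · simpa [hi] using (h i).2

theorem Box.contains_upper_iff {d : ℕ} {R : Box d} {j : Fin d} (hR : R.1 j ≤ R.2 j)
    {x : Fin d → ℝ} :
    (R.upper j).Contains x ↔ R.Contains x ∧ ¬ x j < (R.1 j + R.2 j) / 2 := by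
  simp only [Box.Contains, Box.upper, not_lt]
  constructor
  · intro h
    have hj := h j
    simp only [Function.update_self] at hj
    refine ⟨fun i => ⟨?_, (h i).2⟩, hj.1⟩
    rcases eq_or_ne i j with rfl | hi
    · linarith [hj.1]
    · simpa [hi] using (h i).1
  · rintro ⟨h, hj⟩ i
    refine ⟨?_, (h i).2⟩
    rcases eq_or_ne i j with rfl | hi
    · simpa using hj
    · simpa [hi] using (h i).1

theorem leafBox_succ {d L : ℕ} (j : Fin d) (l u : SplitTree d L) (R : Box d) (x : Fin d → ℝ)
    [Decidable (x j < (R.1 j + R.2 j) / 2)] :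
    leafBox (L + 1) (j, l, u) R x =
      if x j < (R.1 j + R.2 j) / 2 then leafBox L l (R.lower j) x
      else leafBox L u (R.upper j) x := by
  simp only [leafBox, Box.lower, Box.upper]
  split_ifs <;> rfl

theorem leafBox_within {d : ℕ} {a b : ℝ} (x : Fin d → ℝ) :
    ∀ (L : ℕ) (θ : SplitTree d L) {R : Box d}, R.Within a b → (leafBox L θ R x).Within a b
  | 0, _, _, h => h
  | L + 1, (j, l, u), R, h => by
    classical
    rw [leafBox_succ]
    split_ifs
    exacts [leafBox_within x L l (h.lower j), leafBox_within x L u (h.upper j)]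

theorem Box.side_lower {d : ℕ} (R : Box d) (i j : Fin d) :
    (R.lower i).side j = if j = i then R.side j / 2 else R.side j := by
  rcases eq_or_ne j i with rfl | h
  · simp [Box.side, Box.lower]; ring
  · simp [Box.side, Box.lower, h]

theorem Box.side_upper {d : ℕ} (R : Box d) (i j : Fin d) :
    (R.upper i).side j = if j = i then R.side j / 2 else R.side j := by
  rcases eq_or_ne j i with rfl | h
  · simp [Box.side, Box.upper]; ring
  · simp [Box.side, Box.upper, h]

/-- The number of splits of coordinate `j` on the path to a fixed point is binomial with parameters
`L` and `q j`, and every such split divides the squared side by `4`. -/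
theorem treeExp_side_sq {d : ℕ} {q : Fin d → ℝ} (hq : ∑ j, q j = 1) (j : Fin d)
    (x : Fin d → ℝ) (L : ℕ) (R : Box d) :
    (treeExp q L fun θ => (leafBox L θ R x).side j ^ 2) =
      R.side j ^ 2 * (1 - 3 * q j / 4) ^ L := by
  classical
  induction L generalizing R with
  | zero => rw [treeExp_zero]; simp [leafBox]
  | succ L ih =>
    have key : ∀ i, (treeExp q L fun l => treeExp q L fun u =>
        (leafBox (L + 1) (i, l, u) R x).side j ^ 2) =
        R.side j ^ 2 * (1 - 3 * q j / 4) ^ L * (if j = i then 1 / 4 else 1) := by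
      intro i
      simp only [leafBox_succ]
      by_cases hx : x i < (R.1 i + R.2 i) / 2
      · simp only [hx, if_true, treeExp_const hq, ih, Box.side_lower]
        split_ifs <;> ring
      · simp only [hx, if_false, treeExp_const hq, ih, Box.side_upper]
        split_ifs <;> ring
    rw [treeExp_succ]
    simp only [key]
    -- a split of another coordinate leaves the side unchanged
    have h1 : ∀ i, q i * (R.side j ^ 2 * (1 - 3 * q j / 4) ^ L * (if j = i then 1 / 4 else 1)) =
        R.side j ^ 2 * (1 - 3 * q j / 4) ^ L * (q i - 3 / 4 * (if j = i then q i else 0)) := by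
      intro i; split_ifs <;> ring
    simp only [h1, ← Finset.mul_sum, Finset.sum_sub_distrib, hq, Finset.sum_ite_eq,
      Finset.mem_univ, if_true]
    ring

/-! ### Weights -/

open Classical in
theorem leafCount_eq_sum {d n : ℕ} (L : ℕ) (θ : SplitTree d L) (R : Box d) (I : Finset (Fin n))
    (X : Fin n → Fin d → ℝ) (x : Fin d → ℝ) :
    ((leafCount L θ R I X x : ℕ) : ℝ) =
      ∑ i, if i ∈ I ∧ (leafBox L θ R x).Contains (X i) then (1 : ℝ) else 0 := by
  rw [leafCount, Finset.card_filter]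
  push_cast
  rw [← Finset.sum_filter, ← Finset.sum_filter]
  congr 1
  ext i; simp

/-- The weights add up to one, unless the cell is empty and all of them vanish. -/
theorem sum_treeWeight {d n : ℕ} (L : ℕ) (θ : SplitTree d L) (R : Box d) (I : Finset (Fin n))
    (X : Fin n → Fin d → ℝ) (x : Fin d → ℝ) :
    ∑ i, treeWeight L θ R I X x i = 1 - if leafCount L θ R I X x = 0 then 1 else 0 := by
  classical
  have h : ∀ i, treeWeight L θ R I X x i =
      (if i ∈ I ∧ (leafBox L θ R x).Contains (X i) then (1 : ℝ) else 0) *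
        ((leafCount L θ R I X x : ℕ) : ℝ)⁻¹ := by
    intro i; rw [treeWeight, ite_mul, one_mul, zero_mul]
  simp only [h, ← Finset.sum_mul, ← leafCount_eq_sum]
  split_ifs with h0
  · simp [h0]
  · rw [mul_inv_cancel₀ (by exact_mod_cast h0), sub_zero]

theorem treeWeight_nonneg {d n : ℕ} (L : ℕ) (θ : SplitTree d L) (R : Box d) (I : Finset (Fin n))
    (X : Fin n → Fin d → ℝ) (x : Fin d → ℝ) (i : Fin n) : 0 ≤ treeWeight L θ R I X x i := by
  rw [treeWeight]; split_ifs <;> positivity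

theorem treeWeight_le_one {d n : ℕ} (L : ℕ) (θ : SplitTree d L) (R : Box d) (I : Finset (Fin n))
    (X : Fin n → Fin d → ℝ) (x : Fin d → ℝ) (i : Fin n) : treeWeight L θ R I X x i ≤ 1 := by
  refine (Finset.single_le_sum (fun j _ => treeWeight_nonneg L θ R I X x j)
    (Finset.mem_univ i)).trans ?_
  rw [sum_treeWeight]; split_ifs <;> norm_num

theorem treeWeight_eq_zero_of_leafCount {d n : ℕ} {L : ℕ} {θ : SplitTree d L} {R : Box d}
    {I : Finset (Fin n)} {X : Fin n → Fin d → ℝ} {x : Fin d → ℝ}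
    (h : leafCount L θ R I X x = 0) (i : Fin n) : treeWeight L θ R I X x i = 0 := by
  simp [treeWeight, h]

theorem forestWeight_nonneg {d n : ℕ} {q : Fin d → ℝ} (hq : ∀ j, 0 ≤ q j) (L : ℕ) (R : Box d)
    (I : Finset (Fin n)) (X : Fin n → Fin d → ℝ) (x : Fin d → ℝ) (i : Fin n) :
    0 ≤ forestWeight q L R I X x i :=
  treeExp_nonneg hq fun θ => treeWeight_nonneg L θ R I X x i

theorem emptyProb_nonneg {d n : ℕ} {q : Fin d → ℝ} (hq : ∀ j, 0 ≤ q j) (L : ℕ) (R : Box d)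
    (I : Finset (Fin n)) (X : Fin n → Fin d → ℝ) (x : Fin d → ℝ) :
    0 ≤ emptyProb q L R I X x :=
  treeExp_nonneg hq fun θ => by split_ifs <;> norm_num

theorem sum_forestWeight {d n : ℕ} {q : Fin d → ℝ} (hq : ∑ j, q j = 1) (L : ℕ) (R : Box d)
    (I : Finset (Fin n)) (X : Fin n → Fin d → ℝ) (x : Fin d → ℝ) :
    ∑ i, forestWeight q L R I X x i = 1 - emptyProb q L R I X x := by
  simp only [forestWeight, emptyProb, ← treeExp_finset_sum, sum_treeWeight, treeExp_sub,
    treeExp_const hq]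

theorem forestWeight_le_one {d n : ℕ} {q : Fin d → ℝ} (hq0 : ∀ j, 0 ≤ q j) (hq1 : ∑ j, q j = 1)
    (L : ℕ) (R : Box d) (I : Finset (Fin n)) (X : Fin n → Fin d → ℝ) (x : Fin d → ℝ) (i : Fin n) :
    forestWeight q L R I X x i ≤ 1 :=
  (treeExp_mono hq0 fun θ => treeWeight_le_one L θ R I X x i).trans_eq (treeExp_const hq1 L 1)

theorem emptyProb_le_one {d n : ℕ} {q : Fin d → ℝ} (hq0 : ∀ j, 0 ≤ q j) (hq1 : ∑ j, q j = 1)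
    (L : ℕ) (R : Box d) (I : Finset (Fin n)) (X : Fin n → Fin d → ℝ) (x : Fin d → ℝ) :
    emptyProb q L R I X x ≤ 1 :=
  (treeExp_mono hq0 fun θ => by split_ifs <;> norm_num).trans_eq (treeExp_const hq1 L 1)

/-! ### Measurability -/

@[fun_prop]
theorem measurable_leafBox {d : ℕ} :
    ∀ (L : ℕ) (θ : SplitTree d L) (R : Box d), Measurable (leafBox L θ R)
  | 0, _, _ => measurable_const
  | L + 1, (j, l, u), R => by
    classical
    have : leafBox (L + 1) (j, l, u) R = fun x => if x j < (R.1 j + R.2 j) / 2 then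
        leafBox L l (R.lower j) x else leafBox L u (R.upper j) x := by
      ext1 x; rw [leafBox_succ]
    rw [this]
    exact Measurable.ite (measurableSet_lt (measurable_pi_apply j) measurable_const)
      (measurable_leafBox L l _) (measurable_leafBox L u _)

theorem measurableSet_contains {d : ℕ} {Ω : Type*} [MeasurableSpace Ω] {A : Ω → Box d}
    {y : Ω → Fin d → ℝ} (hA : Measurable A) (hy : Measurable y) :
    MeasurableSet {ω | (A ω).Contains (y ω)} := by
  have h : {ω | (A ω).Contains (y ω)} =
      ⋂ j, {ω | (A ω).1 j ≤ y ω j} ∩ {ω | y ω j < (A ω).2 j} := by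
    ext ω; simp [Box.Contains]
  rw [h]
  refine MeasurableSet.iInter fun j => MeasurableSet.inter
    (measurableSet_le ?_ ?_) (measurableSet_lt ?_ ?_) <;> fun_prop

theorem measurable_leafCount {d n : ℕ} (L : ℕ) (θ : SplitTree d L) (R : Box d)
    (I : Finset (Fin n)) :
    Measurable fun z : (Fin d → ℝ) × (Fin n → Fin d → ℝ) =>
      ((leafCount L θ R I z.2 z.1 : ℕ) : ℝ) := by
  classical
  simp only [leafCount_eq_sum]
  refine Finset.measurable_sum _ fun i _ => Measurable.ite ?_ measurable_const measurable_const
  exact (MeasurableSet.const _).inter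
    (measurableSet_contains ((measurable_leafBox L θ R).comp measurable_fst) (by fun_prop))

theorem measurable_treeWeight {d n : ℕ} (L : ℕ) (θ : SplitTree d L) (R : Box d)
    (I : Finset (Fin n)) (i : Fin n) :
    Measurable fun z : (Fin d → ℝ) × (Fin n → Fin d → ℝ) => treeWeight L θ R I z.2 z.1 i := by
  classical
  simp only [treeWeight]
  refine Measurable.ite ?_ (measurable_leafCount L θ R I).inv measurable_const
  exact (MeasurableSet.const _).inter
    (measurableSet_contains ((measurable_leafBox L θ R).comp measurable_fst) (by fun_prop))

theorem measurable_forestWeight {d n : ℕ} (q : Fin d → ℝ) (L : ℕ) (R : Box d)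
    (I : Finset (Fin n)) (i : Fin n) :
    Measurable fun z : (Fin d → ℝ) × (Fin n → Fin d → ℝ) =>
      forestWeight q L R I z.2 z.1 i := by
  simp only [forestWeight, treeExp]
  exact Finset.measurable_sum _ fun θ _ => (measurable_treeWeight L θ R I i).const_mul _

/-! ### The deviation of a single tree -/

/-- The deviation of the prediction of a single tree for the `j`-th coordinate function: the
average of `X i j - x j` over the training points in the cell of `x`, and `0` for an empty cell. -/
noncomputable def treeDev {d n : ℕ} (L : ℕ) (θ : SplitTree d L) (R : Box d) (I : Finset (Fin n))
    (X : Fin n → Fin d → ℝ) (x : Fin d → ℝ) (j : Fin d) : ℝ :=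
  ∑ i, treeWeight L θ R I X x i * (X i j - x j)

theorem treeDev_of_leafCount_eq_zero {d n : ℕ} {L : ℕ} {θ : SplitTree d L} {R : Box d}
    {I : Finset (Fin n)} {X : Fin n → Fin d → ℝ} {x : Fin d → ℝ}
    (h : leafCount L θ R I X x = 0) (j : Fin d) : treeDev L θ R I X x j = 0 :=
  Finset.sum_eq_zero fun i _ => by rw [treeWeight_eq_zero_of_leafCount h, zero_mul]

/-- The average of the training points in a box does not depend on where the test point lies in
that box; this is what makes averaging over the test point worthwhile. -/
theorem exists_treeDev_zero {d n : ℕ} (A : Box d) (I : Finset (Fin n))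
    (X : Fin n → Fin d → ℝ) (j : Fin d) :
    (∀ x, treeDev 0 (rootOnly d) A I X x j = 0) ∨
      ∃ y, A.1 j ≤ y ∧ y ≤ A.2 j ∧ ∀ x, treeDev 0 (rootOnly d) A I X x j = y - x j := by
  classical
  by_cases h : leafCount 0 (rootOnly d) A I X 0 = 0
  · exact Or.inl fun x => treeDev_of_leafCount_eq_zero (x := x) h j
  · right
    have hs : ∑ i, treeWeight 0 (rootOnly d) A I X 0 i = 1 := by
      rw [sum_treeWeight, if_neg h, sub_zero]
    have hb : ∀ i, treeWeight 0 (rootOnly d) A I X 0 i * A.1 j ≤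
          treeWeight 0 (rootOnly d) A I X 0 i * X i j ∧
        treeWeight 0 (rootOnly d) A I X 0 i * X i j ≤
          treeWeight 0 (rootOnly d) A I X 0 i * A.2 j := by
      intro i
      have h0 := treeWeight_nonneg 0 (rootOnly d) A I X 0 i
      rw [treeWeight] at h0 ⊢
      split_ifs at h0 ⊢ with hi
      · exact ⟨mul_le_mul_of_nonneg_left (hi.2 j).1 h0, mul_le_mul_of_nonneg_left (hi.2 j).2.le h0⟩
      · simp
    refine ⟨∑ i, treeWeight 0 (rootOnly d) A I X 0 i * X i j, ?_, ?_, fun x => ?_⟩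
    · calc A.1 j = ∑ i, treeWeight 0 (rootOnly d) A I X 0 i * A.1 j := by
            rw [← Finset.sum_mul, hs, one_mul]
        _ ≤ _ := Finset.sum_le_sum fun i _ => (hb i).1
    · calc _ ≤ ∑ i, treeWeight 0 (rootOnly d) A I X 0 i * A.2 j :=
            Finset.sum_le_sum fun i _ => (hb i).2
        _ = A.2 j := by rw [← Finset.sum_mul, hs, one_mul]
    · calc treeDev 0 (rootOnly d) A I X x j =
            ∑ i, treeWeight 0 (rootOnly d) A I X 0 i * (X i j - x j) := rfl
        _ = _ := by simp only [mul_sub, Finset.sum_sub_distrib, ← Finset.sum_mul, hs, one_mul]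

/-! ### The uniform distribution on a cube -/

theorem isProbabilityMeasure_uniform {a b : ℝ} (hab : a < b) :
    IsProbabilityMeasure (ProbabilityTheory.cond (volume : Measure ℝ) (Set.Icc a b)) :=
  cond_isProbabilityMeasure_of_finite (by simp [hab]) (by simp)

theorem isProbabilityMeasure_uniformCube {d : ℕ} {a b : ℝ} (hab : a < b) :
    IsProbabilityMeasure (uniformCube d a b) := by
  have := isProbabilityMeasure_uniform hab
  unfold uniformCube
  infer_instance

theorem restrict_uniform_Ico {a b l u : ℝ} (hl : a ≤ l) (hu : u ≤ b) :
    (ProbabilityTheory.cond (volume : Measure ℝ) (Set.Icc a b)).restrict (Set.Ico l u) =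
      (ENNReal.ofReal (b - a))⁻¹ • volume.restrict (Set.Ico l u) := by
  have h : Set.Ico l u ∩ Set.Icc a b = Set.Ico l u :=
    Set.inter_eq_left.2 fun x hx => ⟨hl.trans hx.1, hx.2.le.trans hu⟩
  rw [ProbabilityTheory.cond, Measure.restrict_smul, Measure.restrict_restrict measurableSet_Ico,
    h, Real.volume_Icc]

theorem uniform_Ico {a b l u : ℝ} (hab : a < b) (hl : a ≤ l) (hu : u ≤ b) :
    ProbabilityTheory.cond (volume : Measure ℝ) (Set.Icc a b) (Set.Ico l u) =
      ENNReal.ofReal ((u - l) / (b - a)) := by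
  rw [← Measure.restrict_apply_self, restrict_uniform_Ico hl hu]
  simp only [Measure.smul_apply, Measure.restrict_apply_self, Real.volume_Ico, smul_eq_mul]
  rw [div_eq_inv_mul, ENNReal.ofReal_mul (by simp [hab.le]), ENNReal.ofReal_inv_of_pos (by linarith)]

theorem Box.setOf_contains {d : ℕ} (R : Box d) :
    {x | R.Contains x} = Set.univ.pi fun j => Set.Ico (R.1 j) (R.2 j) := by
  ext x; simp [Box.Contains]

theorem Box.measurableSet_setOf_contains {d : ℕ} (R : Box d) : MeasurableSet {x | R.Contains x} :=
  measurableSet_contains measurable_const measurable_id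

theorem uniformCube_box {d : ℕ} {a b : ℝ} (hab : a < b) {R : Box d} (hR : R.Within a b) :
    uniformCube d a b {x | R.Contains x} = ENNReal.ofReal (∏ j, R.side j / (b - a)) := by
  have := isProbabilityMeasure_uniform hab
  rw [R.setOf_contains, uniformCube, Measure.pi_pi, ENNReal.ofReal_prod_of_nonneg]
  · exact Finset.prod_congr rfl fun j _ => uniform_Ico hab (hR.left j) (hR.right j)
  · exact fun j _ => div_nonneg (sub_nonneg.2 (hR.le j)) (by linarith)

theorem cube_within (d : ℕ) {a b : ℝ} (hab : a ≤ b) : (cube d a b).Within a b :=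
  ⟨fun _ => le_rfl, fun _ => hab, fun _ => le_rfl⟩

theorem ae_mem_cube {d : ℕ} {a b : ℝ} (hab : a < b) :
    ∀ᵐ x ∂uniformCube d a b, (cube d a b).Contains x := by
  have := isProbabilityMeasure_uniformCube (d := d) hab
  refine (mem_ae_iff_prob_eq_one (cube d a b).measurableSet_setOf_contains).2 ?_
  rw [uniformCube_box hab (cube_within d hab.le)]
  simp [Box.side, cube, div_self (sub_pos.2 hab).ne']

theorem Box.prod_side_lower {d : ℕ} (R : Box d) (i : Fin d) :
    ∏ j, (R.lower i).side j = (∏ j, R.side j) / 2 := by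
  rw [← Finset.mul_prod_erase _ _ (Finset.mem_univ i),
    ← Finset.mul_prod_erase Finset.univ R.side (Finset.mem_univ i), Box.side_lower, if_pos rfl,
    Finset.prod_congr rfl fun j hj => by rw [Box.side_lower, if_neg (Finset.ne_of_mem_erase hj)]]
  ring

theorem Box.prod_side_upper {d : ℕ} (R : Box d) (i : Fin d) :
    ∏ j, (R.upper i).side j = (∏ j, R.side j) / 2 := by
  rw [← Finset.mul_prod_erase _ _ (Finset.mem_univ i),
    ← Finset.mul_prod_erase Finset.univ R.side (Finset.mem_univ i), Box.side_upper, if_pos rfl,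
    Finset.prod_congr rfl fun j hj => by rw [Box.side_upper, if_neg (Finset.ne_of_mem_erase hj)]]
  ring

theorem prod_side_leafBox {d : ℕ} (x : Fin d → ℝ) :
    ∀ (L : ℕ) (θ : SplitTree d L) (R : Box d),
      ∏ j, (leafBox L θ R x).side j = (∏ j, R.side j) / 2 ^ L
  | 0, _, R => by simp [leafBox]
  | L + 1, (j, l, u), R => by
    classical
    rw [leafBox_succ]
    split_ifs
    · rw [prod_side_leafBox x L l, Box.prod_side_lower, pow_succ', div_div]
    · rw [prod_side_leafBox x L u, Box.prod_side_upper, pow_succ', div_div]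

/-- All cells of a tree of depth `L` have mass `2 ^ (-L)`. -/
theorem uniformCube_leafBox {d : ℕ} {a b : ℝ} (hab : a < b) (L : ℕ) (θ : SplitTree d L)
    (x : Fin d → ℝ) :
    uniformCube d a b {y | (leafBox L θ (cube d a b) x).Contains y} =
      ENNReal.ofReal (1 / 2 ^ L) := by
  rw [uniformCube_box hab (leafBox_within x L θ (cube_within d hab.le)), Finset.prod_div_distrib,
    prod_side_leafBox]
  have : b - a ≠ 0 := (sub_pos.2 hab).ne'
  congr 1
  simp only [Box.side, cube]
  rw [div_div, mul_comm, ← div_div, div_self]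
  exact Finset.prod_ne_zero_iff.2 fun _ _ => this

/-! ### Second moments in a cell -/

/-- For `x` uniform on an interval of length `s`, the mean squared distance to a point of the
interval is at most `s ^ 2 / 3`, with equality at the end points. -/
theorem lintegral_sq_sub_le {l u y : ℝ} (hl : l ≤ y) (hu : y ≤ u) :
    ∫⁻ x in Set.Ico l u, ENNReal.ofReal ((y - x) ^ 2) ≤
      ENNReal.ofReal ((u - l) ^ 2 / 3) * volume (Set.Ico l u) := by
  have hlu := hl.trans hu
  have hint : IntervalIntegrable (fun x : ℝ => (y - x) ^ 2) volume l u :=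
    Continuous.intervalIntegrable (by fun_prop) _ _
  rw [Measure.restrict_congr_set Ico_ae_eq_Ioc, ← ofReal_integral_eq_lintegral_ofReal
    ((intervalIntegrable_iff_integrableOn_Ioc_of_le hlu).1 hint)
    (Eventually.of_forall fun x => sq_nonneg _), ← intervalIntegral.integral_of_le hlu,
    Real.volume_Ico, ← ENNReal.ofReal_mul (by positivity)]
  refine ENNReal.ofReal_le_ofReal ?_
  rw [intervalIntegral.integral_comp_sub_left (fun x => x ^ 2) y, integral_pow]
  norm_num
  -- `s ^ 3 + t ^ 3 ≤ (s + t) ^ 3` with `s = y - l` and `t = u - y`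
  nlinarith [mul_nonneg (mul_nonneg (sub_nonneg.2 hl) (sub_nonneg.2 hu)) (sub_nonneg.2 hlu)]

/-- The one-dimensional bound on one coordinate of a sub-box; the other coordinates contribute the
same factor to both sides. -/
theorem setLIntegral_sq_sub_le {d : ℕ} {a b : ℝ} (hab : a < b) {A : Box d} (hA : A.Within a b)
    {j : Fin d} {y : ℝ} (hl : A.1 j ≤ y) (hu : y ≤ A.2 j) :
    ∫⁻ x in {x | A.Contains x}, ENNReal.ofReal ((y - x j) ^ 2) ∂uniformCube d a b ≤
      ∫⁻ _ in {x | A.Contains x}, ENNReal.ofReal (A.side j ^ 2 / 3) ∂uniformCube d a b := by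
  have := isProbabilityMeasure_uniform hab
  rw [A.setOf_contains, uniformCube, Measure.restrict_pi_pi]
  have key : ∀ g : ℝ → ℝ≥0∞, Measurable g → ∫⁻ x : Fin d → ℝ, g (x j) ∂Measure.pi
        (fun i => (ProbabilityTheory.cond volume (Set.Icc a b)).restrict (Set.Ico (A.1 i) (A.2 i)))
      = _ := fun g hg =>
    (lintegral_map hg (measurable_pi_apply j)).symm.trans
      (congrArg (fun μ => lintegral μ g) (Measure.pi_map_eval _ j))
  rw [key (fun t => ENNReal.ofReal ((y - t) ^ 2)) (by fun_prop),
    key (fun _ => ENNReal.ofReal (A.side j ^ 2 / 3)) measurable_const]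
  rw [lintegral_smul_measure, lintegral_smul_measure, restrict_uniform_Ico (hA.left j) (hA.right j),
    lintegral_smul_measure, lintegral_smul_measure]
  refine mul_le_mul_right (mul_le_mul_right ?_ _) _
  rw [setLIntegral_const]
  exact lintegral_sq_sub_le hl hu

/-- An inequality between integrals over each single box passes to the cells of a tree: every split
cuts the domain of integration in two. Working with `∫⁻` spares all integrability side conditions. -/
theorem lintegral_leafBox_le {d : ℕ} {a b : ℝ} (μ : Measure (Fin d → ℝ))
    {h : Box d → (Fin d → ℝ) → ℝ≥0∞} {g : Box d → ℝ≥0∞}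
    (hg : ∀ A : Box d, A.Within a b →
      ∫⁻ x in {x | A.Contains x}, h A x ∂μ ≤ ∫⁻ _ in {x | A.Contains x}, g A ∂μ) :
    ∀ (L : ℕ) (θ : SplitTree d L) (R : Box d), R.Within a b →
      ∫⁻ x in {x | R.Contains x}, h (leafBox L θ R x) x ∂μ ≤
        ∫⁻ x in {x | R.Contains x}, g (leafBox L θ R x) ∂μ
  | 0, _, R, hR => hg R hR
  | L + 1, (j, l, u), R, hR => by
    classical
    have hU : {x | R.Contains x} = {x | (R.lower j).Contains x} ∪ {x | (R.upper j).Contains x} := by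
      ext x
      simp only [Set.mem_ofPred_eq, Set.mem_union, Box.contains_lower_iff (hR.le j),
        Box.contains_upper_iff (hR.le j), ← and_or_left, em, and_true]
    have hD : Disjoint {x | (R.lower j).Contains x} {x | (R.upper j).Contains x} := by
      rw [Set.disjoint_left]
      intro x hx hx'
      exact ((Box.contains_upper_iff (hR.le j)).1 hx').2 ((Box.contains_lower_iff (hR.le j)).1 hx).2
    have e1 : ∀ x ∈ {x | (R.lower j).Contains x},
        leafBox (L + 1) (j, l, u) R x = leafBox L l (R.lower j) x := fun x hx => by
      rw [leafBox_succ, if_pos ((Box.contains_lower_iff (hR.le j)).1 hx).2]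
    have e2 : ∀ x ∈ {x | (R.upper j).Contains x},
        leafBox (L + 1) (j, l, u) R x = leafBox L u (R.upper j) x := fun x hx => by
      rw [leafBox_succ, if_neg ((Box.contains_upper_iff (hR.le j)).1 hx).2]
    have m1 := (R.lower j).measurableSet_setOf_contains
    have m2 := (R.upper j).measurableSet_setOf_contains
    have i1 : ∀ F : Box d → (Fin d → ℝ) → ℝ≥0∞,
        ∫⁻ x in {x | R.Contains x}, F (leafBox (L + 1) (j, l, u) R x) x ∂μ =
          ∫⁻ x in {x | (R.lower j).Contains x}, F (leafBox L l (R.lower j) x) x ∂μ +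
          ∫⁻ x in {x | (R.upper j).Contains x}, F (leafBox L u (R.upper j) x) x ∂μ := fun F => by
      rw [hU, lintegral_union m2 hD]
      exact congrArg₂ _ (setLIntegral_congr_fun m1 fun x hx => by rw [e1 x hx])
        (setLIntegral_congr_fun m2 fun x hx => by rw [e2 x hx])
    rw [i1 h, i1 fun A _ => g A]
    exact add_le_add (lintegral_leafBox_le μ hg L l _ (hR.lower j))
      (lintegral_leafBox_le μ hg L u _ (hR.upper j))

theorem measurable_treeDev {d n : ℕ} (L : ℕ) (θ : SplitTree d L) (R : Box d)
    (I : Finset (Fin n)) (j : Fin d) :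
    Measurable fun z : (Fin d → ℝ) × (Fin n → Fin d → ℝ) => treeDev L θ R I z.2 z.1 j :=
  Finset.measurable_sum _ fun i _ => (measurable_treeWeight L θ R I i).mul (by fun_prop)

theorem lintegral_treeDev_sq_le {d n : ℕ} {a b : ℝ} (hab : a < b) (L : ℕ) (θ : SplitTree d L)
    (I : Finset (Fin n)) (X : Fin n → Fin d → ℝ) (j : Fin d) :
    ∫⁻ x, ENNReal.ofReal (treeDev L θ (cube d a b) I X x j ^ 2) ∂uniformCube d a b ≤
      ∫⁻ x, ENNReal.ofReal ((leafBox L θ (cube d a b) x).side j ^ 2 / 3) ∂uniformCube d a b := by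
  -- the root box is half-open, but it carries the whole mass
  have hcube : (uniformCube d a b).restrict {x | (cube d a b).Contains x} = uniformCube d a b :=
    Measure.restrict_eq_self_of_ae_mem (ae_mem_cube hab)
  have := lintegral_leafBox_le (a := a) (b := b) (uniformCube d a b)
    (h := fun A x => ENNReal.ofReal (treeDev 0 (rootOnly d) A I X x j ^ 2))
    (g := fun A => ENNReal.ofReal (A.side j ^ 2 / 3)) (fun A hA => ?_) L θ (cube d a b)
    (cube_within d hab.le)
  · rw [hcube] at this
    exact this
  · rcases exists_treeDev_zero A I X j with h | ⟨y, hl, hu, h⟩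
    · simp [h]
    · simp only [h]
      exact setLIntegral_sq_sub_le hab hA hl hu

/-- Mean squared deviation of the average in the cell, for fixed training points. The training
points may be arbitrary; all randomness comes from the tree and from the test point. -/
theorem lintegral_treeExp_treeDev_sq_le {d n : ℕ} {a b : ℝ} (hab : a < b) {q : Fin d → ℝ}
    (hq0 : ∀ j, 0 ≤ q j) (hq1 : ∑ j, q j = 1) (L : ℕ)
    (I : Finset (Fin n)) (X : Fin n → Fin d → ℝ) (j : Fin d) :
    ∫⁻ x, ENNReal.ofReal (treeExp q L fun θ => treeDev L θ (cube d a b) I X x j ^ 2)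
        ∂uniformCube d a b ≤
      ENNReal.ofReal ((b - a) ^ 2 / 3 * (1 - 3 * q j / 4) ^ L) := by
  have := isProbabilityMeasure_uniformCube (d := d) hab
  have expand : ∀ g : SplitTree d L → ℝ, (∀ θ, 0 ≤ g θ) → ENNReal.ofReal (treeExp q L g) =
      ∑ θ, ENNReal.ofReal (treeProb q L θ) * ENNReal.ofReal (g θ) := fun g hg => by
    rw [treeExp, ENNReal.ofReal_sum_of_nonneg
      fun θ _ => mul_nonneg (treeProb_nonneg hq0 L θ) (hg θ)]
    exact Finset.sum_congr rfl fun θ _ => ENNReal.ofReal_mul (treeProb_nonneg hq0 L θ)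
  have hmeas : ∀ θ : SplitTree d L, Measurable fun x =>
      ENNReal.ofReal ((leafBox L θ (cube d a b) x).side j ^ 2 / 3) := fun θ => by
    unfold Box.side; fun_prop
  have hmeas' : ∀ θ : SplitTree d L, Measurable fun x =>
      ENNReal.ofReal (treeDev L θ (cube d a b) I X x j ^ 2) := fun θ =>
    (((measurable_treeDev L θ (cube d a b) I j).comp
      (measurable_id.prodMk measurable_const)).pow_const 2).ennreal_ofReal
  calc ∫⁻ x, ENNReal.ofReal (treeExp q L fun θ => treeDev L θ (cube d a b) I X x j ^ 2)
        ∂uniformCube d a b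
      = ∑ θ, ENNReal.ofReal (treeProb q L θ) *
          ∫⁻ x, ENNReal.ofReal (treeDev L θ (cube d a b) I X x j ^ 2) ∂uniformCube d a b := by
        simp_rw [expand _ fun θ => sq_nonneg _]
        rw [lintegral_finsetSum _ fun θ _ => (hmeas' θ).const_mul _]
        exact Finset.sum_congr rfl fun θ _ => lintegral_const_mul _ (hmeas' θ)
    _ ≤ ∑ θ, ENNReal.ofReal (treeProb q L θ) *
          ∫⁻ x, ENNReal.ofReal ((leafBox L θ (cube d a b) x).side j ^ 2 / 3)
            ∂uniformCube d a b := by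
        exact Finset.sum_le_sum fun θ _ =>
          mul_le_mul_right (lintegral_treeDev_sq_le hab L θ I X j) _
    _ = ∫⁻ x, ENNReal.ofReal (treeExp q L fun θ =>
          (leafBox L θ (cube d a b) x).side j ^ 2 / 3) ∂uniformCube d a b := by
        simp_rw [expand _ fun θ => div_nonneg (sq_nonneg _) (by norm_num : (0 : ℝ) ≤ 3)]
        rw [lintegral_finsetSum _ fun θ _ => (hmeas θ).const_mul _]
        exact Finset.sum_congr rfl fun θ _ => (lintegral_const_mul _ (hmeas θ)).symm
    _ = ENNReal.ofReal ((b - a) ^ 2 / 3 * (1 - 3 * q j / 4) ^ L) := by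
        simp only [div_eq_mul_inv, treeExp_mul_const]
        simp only [treeExp_side_sq hq1, lintegral_const, measure_univ, mul_one]
        congr 1
        simp only [Box.side, cube]
        ring

/-! ### Moments of the coefficients -/

open Classical in
/-- The law of the coefficient of feature `j`. -/
noncomputable def coefLaw {d : ℕ} (S : Finset (Fin d)) (j : Fin d) : Measure ℝ :=
  if j ∈ S then gaussianReal 0 1 else Measure.dirac 0

instance isProbabilityMeasure_coefLaw {d : ℕ} (S : Finset (Fin d)) (j : Fin d) :
    IsProbabilityMeasure (coefLaw S j) := by
  unfold coefLaw; split_ifs <;> infer_instance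

theorem betaLaw_eq_pi {d : ℕ} (S : Finset (Fin d)) : betaLaw S = Measure.pi (coefLaw S) := rfl

instance isProbabilityMeasure_betaLaw {d : ℕ} (S : Finset (Fin d)) :
    IsProbabilityMeasure (betaLaw S) := by
  rw [betaLaw_eq_pi]; infer_instance

theorem memLp_coefLaw {d : ℕ} (S : Finset (Fin d)) (j : Fin d) :
    MemLp (id : ℝ → ℝ) 2 (coefLaw S j) := by
  unfold coefLaw
  split_ifs
  · exact memLp_id_gaussianReal 2
  · exact (memLp_const (0 : ℝ)).ae_eq (by rw [Filter.EventuallyEq, ae_dirac_eq]; rfl)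

theorem integral_coefLaw {d : ℕ} (S : Finset (Fin d)) (j : Fin d) :
    ∫ t, t ∂coefLaw S j = 0 := by
  unfold coefLaw; split_ifs <;> simp

theorem variance_coefLaw_mul {d : ℕ} (S : Finset (Fin d)) (j : Fin d) (r : ℝ) :
    Var[fun t => t * r; coefLaw S j] = if j ∈ S then r ^ 2 else 0 := by
  unfold coefLaw
  split_ifs
  · simp [variance_mul_const, variance_fun_id_gaussianReal]
  · rw [variance_dirac]

theorem memLp_betaLaw_eval {d : ℕ} (S : Finset (Fin d)) (j : Fin d) :
    MemLp (fun β : Fin d → ℝ => β j) 2 (betaLaw S) :=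
  (memLp_coefLaw S j).comp_measurePreserving (measurePreserving_eval (coefLaw S) j)

/-- Independent centered coefficients produce no cross terms. -/
theorem integral_betaLaw_sq {d : ℕ} (S : Finset (Fin d)) (v : Fin d → ℝ) :
    ∫ β, (∑ j, β j * v j) ^ 2 ∂betaLaw S = ∑ j ∈ S, v j ^ 2 := by
  have hmean : ∫ β, ∑ j, β j * v j ∂betaLaw S = 0 := by
    rw [integral_finsetSum _ fun j _ =>
      ((memLp_betaLaw_eval S j).integrable one_le_two).mul_const _]
    refine Finset.sum_eq_zero fun j _ => ?_
    rw [integral_mul_const, betaLaw_eq_pi,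
      integral_comp_eval (μ := coefLaw S) (f := fun t => t) measurable_id.aestronglyMeasurable,
      integral_coefLaw, zero_mul]
  have hv := variance_sum_pi (μ := coefLaw S) (X := fun j t => t * v j)
    fun j => (memLp_coefLaw S j).mul_const (v j)
  have e : (∑ i, fun β : Fin d → ℝ => β i * v i) = fun β => ∑ i, β i * v i := by
    ext β; simp
  simp only [e, variance_coefLaw_mul, Finset.sum_ite_mem, Finset.univ_inter] at hv
  rw [← hv, ← betaLaw_eq_pi, variance_of_integral_eq_zero _ hmean]
  exact Measurable.aemeasurable (by fun_prop)

/-! ### Linear forms in the coefficients -/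

section LinearForm

variable {d : ℕ} {Ω Ω' : Type*} [MeasurableSpace Ω] [MeasurableSpace Ω'] {P : Measure Ω}
  {Q : Measure Ω'} [IsProbabilityMeasure P] [IsProbabilityMeasure Q] (S : Finset (Fin d))

/-- A linear form in the coefficients whose weights are bounded functions of the covariates is
square integrable. -/
theorem memLp_linearForm {A : Fin d → Ω × Ω' → ℝ} (hA : ∀ j, Measurable (A j)) {C : ℝ}
    (hC : ∀ j, ∀ᵐ ω ∂P.prod Q, |A j ω| ≤ C) :
    MemLp (fun z : ((Fin d → ℝ) × Ω) × Ω' => ∑ j, z.1.1 j * A j (z.1.2, z.2)) 2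
      (((betaLaw S).prod P).prod Q) := by
  have h : MemLp (fun z : (Fin d → ℝ) × (Ω × Ω') => ∑ j, z.1 j * A j z.2) 2
      ((betaLaw S).prod (P.prod Q)) := by
    refine memLp_finsetSum _ fun j _ => ?_
    refine ((memLp_betaLaw_eval S j).comp_fst (P.prod Q)).of_le_mul (c := C) ?_ ?_
    · exact Measurable.aestronglyMeasurable
        (Measurable.mul (by fun_prop) ((hA j).comp measurable_snd))
    · filter_upwards [Measure.quasiMeasurePreserving_snd.ae (hC j)] with z hz
      rw [norm_mul, mul_comm]
      exact mul_le_mul_of_nonneg_right hz (norm_nonneg _)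
  exact h.comp_measurePreserving (measurePreserving_prodAssoc _ _ _)

theorem integral_linearForm_sq {A : Fin d → Ω × Ω' → ℝ} (hA : ∀ j, Measurable (A j)) {C : ℝ}
    (hC : ∀ j, ∀ᵐ ω ∂P.prod Q, |A j ω| ≤ C) :
    ∫ z : ((Fin d → ℝ) × Ω) × Ω', (∑ j, z.1.1 j * A j (z.1.2, z.2)) ^ 2
      ∂(((betaLaw S).prod P).prod Q) = ∑ j ∈ S, ∫ ω, A j ω ^ 2 ∂P.prod Q := by
  have hint : Integrable (fun z : (Fin d → ℝ) × (Ω × Ω') => (∑ j, z.1 j * A j z.2) ^ 2)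
      ((betaLaw S).prod (P.prod Q)) := by
    refine ((measurePreserving_prodAssoc (betaLaw S) P Q).integrable_comp_emb
      MeasurableEquiv.prodAssoc.measurableEmbedding).1 ?_
    exact (memLp_linearForm S hA hC).integrable_sq
  calc _ = ∫ z : (Fin d → ℝ) × (Ω × Ω'), (∑ j, z.1 j * A j z.2) ^ 2
        ∂((betaLaw S).prod (P.prod Q)) :=
      (measurePreserving_prodAssoc (betaLaw S) P Q).integral_comp'
        (fun z : (Fin d → ℝ) × (Ω × Ω') => (∑ j, z.1 j * A j z.2) ^ 2)
    _ = ∫ ω, ∑ j ∈ S, A j ω ^ 2 ∂P.prod Q := by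
      rw [integral_prod_symm _ hint]
      exact integral_congr_ae (Eventually.of_forall fun ω => integral_betaLaw_sq S fun j => A j ω)
    _ = _ := integral_finsetSum _ fun j _ =>
      (MemLp.of_bound (p := 2) (hA j).aestronglyMeasurable C (hC j)).integrable_sq

end LinearForm

/-! ### The laws of the covariates -/

section Laws

variable {d K n : ℕ} {a b : Fin K → ℝ}

theorem isProbabilityMeasure_trainLaw (hab : ∀ t, a t < b t) (c : Fin n → Fin K) :
    IsProbabilityMeasure (trainLaw d a b c) := by
  have := fun t => isProbabilityMeasure_uniformCube (d := d) (hab t)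
  unfold trainLaw; infer_instance

theorem isProbabilityMeasure_testLaw [NeZero K] (hab : ∀ t, a t < b t) :
    IsProbabilityMeasure (testLaw d a b) := by
  have := fun t => isProbabilityMeasure_uniformCube (d := d) (hab t)
  constructor
  have : ∀ t : Fin K, (uniformCube d (a t) (b t)).map (Prod.mk t) Set.univ = 1 := fun t => by
    rw [Measure.map_apply measurable_prodMk_left MeasurableSet.univ]; simp
  simp only [testLaw, Measure.finsetSum_apply, Measure.smul_apply, this, smul_eq_mul, mul_one,
    Finset.sum_const, Finset.card_univ, Fintype.card_fin, nsmul_eq_mul]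
  exact ENNReal.mul_inv_cancel (by simp [NeZero.ne K]) (by simp)

theorem ae_trainLaw (hab : ∀ t, a t < b t) (c : Fin n → Fin K) :
    ∀ᵐ X ∂trainLaw d a b c, ∀ i, (cube d (a (c i)) (b (c i))).Contains (X i) := by
  have := fun t => isProbabilityMeasure_uniformCube (d := d) (hab t)
  exact eventually_all.2 fun i => Measure.tendsto_eval_ae_ae.eventually (ae_mem_cube (hab (c i)))

theorem ae_testLaw (hab : ∀ t, a t < b t) :
    ∀ᵐ z ∂testLaw d a b, (cube d (a z.1) (b z.1)).Contains z.2 := by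
  rw [testLaw, ae_finsetSum_measure_iff]
  intro t _
  refine Measure.ae_smul_measure ?_ _
  have hm : MeasurableSet {z : Fin K × (Fin d → ℝ) | (cube d (a z.1) (b z.1)).Contains z.2} :=
    measurableSet_contains (A := fun z : Fin K × (Fin d → ℝ) => cube d (a z.1) (b z.1))
      (by have := (measurable_from_top (f := fun t => cube d (a t) (b t)) : Measurable _)
          exact this.comp measurable_fst) measurable_snd
  exact (ae_map_iff measurable_prodMk_left.aemeasurable hm).2 (ae_mem_cube (hab t))

theorem lintegral_testLaw_le [NeZero K] (f : Fin K × (Fin d → ℝ) → ℝ≥0∞) (hf : Measurable f)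
    {r : ℝ≥0∞} (h : ∀ t, ∫⁻ x, f (t, x) ∂uniformCube d (a t) (b t) ≤ r) :
    ∫⁻ z, f z ∂testLaw d a b ≤ r := by
  rw [testLaw, lintegral_finsetSum_measure]
  calc _ = ∑ t : Fin K, (K : ℝ≥0∞)⁻¹ * ∫⁻ x, f (t, x) ∂uniformCube d (a t) (b t) := by
        refine Finset.sum_congr rfl fun t _ => ?_
        rw [lintegral_smul_measure, lintegral_map hf measurable_prodMk_left, smul_eq_mul]
    _ ≤ ∑ t : Fin K, (K : ℝ≥0∞)⁻¹ * r := Finset.sum_le_sum fun t _ => mul_le_mul_right (h t) _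
    _ = r := by
        rw [Finset.sum_const, Finset.card_univ, Fintype.card_fin, nsmul_eq_mul, ← mul_assoc,
          ENNReal.mul_inv_cancel (by simp [NeZero.ne K]) (by simp), one_mul]

/-- A bound for the absolute values of all coordinates of all covariates. -/
def reach (a b : Fin K → ℝ) : ℝ := ∑ t, (|a t| + |b t|)

theorem abs_le_reach {t : Fin K} {x : Fin d → ℝ} (hx : (cube d (a t) (b t)).Contains x)
    (j : Fin d) : |x j| ≤ reach a b := by
  have h1 : |a t| + |b t| ≤ reach a b :=
    Finset.single_le_sum (f := fun t => |a t| + |b t|) (fun _ _ => by positivity)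
      (Finset.mem_univ t)
  refine le_trans ?_ h1
  obtain ⟨h2, h3⟩ := hx j
  simp only [cube] at h2 h3
  rw [abs_le]
  constructor <;> linarith [neg_abs_le (a t), le_abs_self (b t), abs_nonneg (a t), abs_nonneg (b t)]

theorem ae_abs_le_reach [NeZero K] (hab : ∀ t, a t < b t) (c : Fin n → Fin K) :
    ∀ᵐ ω ∂(testLaw d a b).prod (trainLaw d a b c),
      (∀ j, |ω.1.2 j| ≤ reach a b) ∧ ∀ i j, |ω.2 i j| ≤ reach a b := by
  have := isProbabilityMeasure_testLaw (d := d) hab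
  have := isProbabilityMeasure_trainLaw (d := d) hab c
  filter_upwards [Measure.quasiMeasurePreserving_fst.ae (ae_testLaw (d := d) hab),
    Measure.quasiMeasurePreserving_snd.ae (ae_trainLaw (d := d) hab c)] with ω h1 h2
  exact ⟨abs_le_reach h1, fun i => abs_le_reach (h2 i)⟩

end Laws

/-! ### Forests trained on a label-dependent set of points -/

section Forest

variable {d K n : ℕ} (a b : Fin K → ℝ) (q : Fin d → ℝ) (L : ℕ) (I : Fin K → Finset (Fin n))

/-- The forest that predicts at points with label `B` by partitioning the cube of cluster `B` and
averaging over the training points with index in `I B`. The Ensemble is the case in which `I B` is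
cluster `B`, the Merged forest the case in which `I B` contains all indices. -/
noncomputable def forest : Learner d K n := fun B x X i =>
  forestWeight q L (cube d (a B) (b B)) (I B) X x i

/-- The probability, over the random tree, that `forest` has no training point to average over. -/
noncomputable def forestEmpty (B : Fin K) (x : Fin d → ℝ) (X : Fin n → Fin d → ℝ) : ℝ :=
  emptyProb q L (cube d (a B) (b B)) (I B) X x

/-- The deviation of the weighted average of the `j`-th coordinates from `x j`, with the weights of
the forest. As a function of the coefficients, `∑ i, W i * (f (X i) - f x)` is the linear form with
these weights. -/
noncomputable def forestDev (j : Fin d) (ω : (Fin K × (Fin d → ℝ)) × (Fin n → Fin d → ℝ)) : ℝ :=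
  ∑ i, forest a b q L I ω.1.1 ω.1.2 ω.2 i * (ω.2 i j - ω.1.2 j)

/-- The squared deviation of a single tree, averaged over the trees. -/
noncomputable def treeSqDev (j : Fin d) (ω : (Fin K × (Fin d → ℝ)) × (Fin n → Fin d → ℝ)) : ℝ :=
  treeExp q L fun θ => treeDev L θ (cube d (a ω.1.1) (b ω.1.1)) (I ω.1.1) ω.2 ω.1.2 j ^ 2

/-- The label takes finitely many values, so that measurability may be checked label by label. -/
theorem measurable_of_label {f : (Fin K × (Fin d → ℝ)) × (Fin n → Fin d → ℝ) → ℝ}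
    (hf : ∀ t, Measurable fun z : (Fin d → ℝ) × (Fin n → Fin d → ℝ) => f ((t, z.1), z.2)) :
    Measurable f := by
  have : Measurable fun w : Fin K × ((Fin d → ℝ) × (Fin n → Fin d → ℝ)) =>
      f ((w.1, w.2.1), w.2.2) := measurable_from_prod_countable_right hf
  exact this.comp MeasurableEquiv.prodAssoc.measurable

theorem measurable_forest (i : Fin n) :
    Measurable fun ω : (Fin K × (Fin d → ℝ)) × (Fin n → Fin d → ℝ) =>
      forest a b q L I ω.1.1 ω.1.2 ω.2 i := by
  refine measurable_of_label
    (f := fun ω => forest a b q L I ω.1.1 ω.1.2 ω.2 i) fun t => ?_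
  exact measurable_forestWeight q L (cube d (a t) (b t)) (I t) i

theorem measurable_forestDev (j : Fin d) : Measurable (forestDev (n := n) a b q L I j) :=
  Finset.measurable_sum _ fun i _ => (measurable_forest a b q L I i).mul (by fun_prop)

theorem measurable_treeSqDev (j : Fin d) : Measurable (treeSqDev (n := n) a b q L I j) := by
  refine measurable_of_label fun t => ?_
  exact Finset.measurable_sum _ fun θ _ =>
    ((measurable_treeDev L θ (cube d (a t) (b t)) (I t) j).pow_const 2).const_mul _

variable {q}

theorem forest_nonneg (hq0 : ∀ j, 0 ≤ q j) (B : Fin K) (x : Fin d → ℝ)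
    (X : Fin n → Fin d → ℝ) (i : Fin n) : 0 ≤ forest a b q L I B x X i :=
  forestWeight_nonneg hq0 _ _ _ _ _ _

theorem forest_le_one (hq0 : ∀ j, 0 ≤ q j) (hq1 : ∑ j, q j = 1) (B : Fin K) (x : Fin d → ℝ)
    (X : Fin n → Fin d → ℝ) (i : Fin n) : forest a b q L I B x X i ≤ 1 :=
  forestWeight_le_one hq0 hq1 _ _ _ _ _ _

theorem sum_forest (hq1 : ∑ j, q j = 1) (B : Fin K) (x : Fin d → ℝ) (X : Fin n → Fin d → ℝ) :
    ∑ i, forest a b q L I B x X i = 1 - forestEmpty a b q L I B x X :=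
  sum_forestWeight hq1 _ _ _ _ _

theorem measurable_forestEmpty (hq1 : ∑ j, q j = 1) :
    Measurable fun ω : (Fin K × (Fin d → ℝ)) × (Fin n → Fin d → ℝ) =>
      forestEmpty a b q L I ω.1.1 ω.1.2 ω.2 := by
  have h : ∀ ω : (Fin K × (Fin d → ℝ)) × (Fin n → Fin d → ℝ),
      forestEmpty a b q L I ω.1.1 ω.1.2 ω.2 =
        1 - ∑ i, forest a b q L I ω.1.1 ω.1.2 ω.2 i := fun ω => by rw [sum_forest a b L I hq1]; ring
  simp only [h]
  exact measurable_const.sub (Finset.measurable_sum _ fun i _ => measurable_forest a b q L I i)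

theorem forestEmpty_nonneg (hq0 : ∀ j, 0 ≤ q j) (B : Fin K) (x : Fin d → ℝ)
    (X : Fin n → Fin d → ℝ) : 0 ≤ forestEmpty a b q L I B x X :=
  emptyProb_nonneg hq0 _ _ _ _ _

theorem forestEmpty_le_one (hq0 : ∀ j, 0 ≤ q j) (hq1 : ∑ j, q j = 1) (B : Fin K)
    (x : Fin d → ℝ) (X : Fin n → Fin d → ℝ) : forestEmpty a b q L I B x X ≤ 1 :=
  emptyProb_le_one hq0 hq1 _ _ _ _ _

theorem forestDev_eq (j : Fin d) (ω : (Fin K × (Fin d → ℝ)) × (Fin n → Fin d → ℝ)) :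
    forestDev a b q L I j ω = treeExp q L fun θ =>
      treeDev L θ (cube d (a ω.1.1) (b ω.1.1)) (I ω.1.1) ω.2 ω.1.2 j := by
  simp only [forestDev, forest, forestWeight, treeDev, treeExp_finset_sum, treeExp_mul_const]

theorem forestDev_sq_le (hq0 : ∀ j, 0 ≤ q j) (hq1 : ∑ j, q j = 1) (j : Fin d)
    (ω : (Fin K × (Fin d → ℝ)) × (Fin n → Fin d → ℝ)) :
    forestDev a b q L I j ω ^ 2 ≤ treeSqDev a b q L I j ω := by
  rw [forestDev_eq]; exact treeExp_sq_le hq0 hq1 L _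

/-- On a tree whose cell is empty the deviation vanishes, so the two contributions never occur
together and no cross term arises. -/
theorem forestDev_sub_sq_le (hq0 : ∀ j, 0 ≤ q j) (hq1 : ∑ j, q j = 1) (j : Fin d)
    (ω : (Fin K × (Fin d → ℝ)) × (Fin n → Fin d → ℝ)) :
    (forestDev a b q L I j ω - ω.1.2 j * forestEmpty a b q L I ω.1.1 ω.1.2 ω.2) ^ 2 ≤
      treeSqDev a b q L I j ω + ω.1.2 j ^ 2 * forestEmpty a b q L I ω.1.1 ω.1.2 ω.2 := by
  rw [forestDev_eq, forestEmpty, emptyProb, treeSqDev, mul_comm (ω.1.2 j),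
    mul_comm (ω.1.2 j ^ 2), ← treeExp_mul_const, ← treeExp_mul_const, ← treeExp_sub, ← treeExp_add]
  refine (treeExp_sq_le hq0 hq1 L _).trans (treeExp_mono hq0 fun θ => ?_)
  split_ifs with h
  · rw [treeDev_of_leafCount_eq_zero h]; nlinarith
  · simp

theorem treeSqDev_nonneg (hq0 : ∀ j, 0 ≤ q j) (j : Fin d)
    (ω : (Fin K × (Fin d → ℝ)) × (Fin n → Fin d → ℝ)) : 0 ≤ treeSqDev a b q L I j ω :=
  treeExp_nonneg hq0 fun _ => sq_nonneg _

variable {a b} {ω₀ : ℝ} [NeZero K] (c : Fin n → Fin K)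

theorem lintegral_treeSqDev_le (hω : 0 < ω₀) (hab : ∀ t, b t - a t = ω₀)
    (hq0 : ∀ j, 0 ≤ q j) (hq1 : ∑ j, q j = 1) (j : Fin d) :
    ∫⁻ ω, ENNReal.ofReal (treeSqDev a b q L I j ω) ∂(testLaw d a b).prod (trainLaw d a b c) ≤
      ENNReal.ofReal (ω₀ ^ 2 / 3 * (1 - 3 * q j / 4) ^ L) := by
  have hlt : ∀ t, a t < b t := fun t => by linarith [hab t]
  have := isProbabilityMeasure_testLaw (d := d) hlt
  have := isProbabilityMeasure_trainLaw (d := d) hlt c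
  have hm := (measurable_treeSqDev a b q L I j).ennreal_ofReal
  rw [lintegral_prod_symm _ hm.aemeasurable]
  calc _ ≤ ∫⁻ _, ENNReal.ofReal (ω₀ ^ 2 / 3 * (1 - 3 * q j / 4) ^ L) ∂trainLaw d a b c := by
        refine lintegral_mono fun X => lintegral_testLaw_le _ ?_ fun t => ?_
        · exact hm.comp measurable_prodMk_right
        · rw [← hab t]
          exact lintegral_treeExp_treeDev_sq_le (hlt t) hq0 hq1 L (I t) X j
    _ = _ := by simp

theorem integrable_treeSqDev (hω : 0 < ω₀) (hab : ∀ t, b t - a t = ω₀)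
    (hq0 : ∀ j, 0 ≤ q j) (hq1 : ∑ j, q j = 1) (j : Fin d) :
    Integrable (treeSqDev a b q L I j) ((testLaw d a b).prod (trainLaw d a b c)) := by
  refine ⟨(measurable_treeSqDev a b q L I j).aestronglyMeasurable, ?_⟩
  rw [hasFiniteIntegral_iff_ofReal (Eventually.of_forall (treeSqDev_nonneg a b L I hq0 j))]
  exact (lintegral_treeSqDev_le L I c hω hab hq0 hq1 j).trans_lt ENNReal.ofReal_lt_top

theorem integral_treeSqDev_le (hω : 0 < ω₀) (hab : ∀ t, b t - a t = ω₀)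
    (hq0 : ∀ j, 0 ≤ q j) (hq1 : ∑ j, q j = 1) (j : Fin d) (hqj : 0 ≤ 1 - 3 * q j / 4) :
    ∫ ω, treeSqDev a b q L I j ω ∂(testLaw d a b).prod (trainLaw d a b c) ≤
      ω₀ ^ 2 / 3 * (1 - 3 * q j / 4) ^ L := by
  rw [integral_eq_lintegral_of_nonneg_ae (Eventually.of_forall (treeSqDev_nonneg a b L I hq0 j))
    (measurable_treeSqDev a b q L I j).aestronglyMeasurable]
  exact ENNReal.toReal_le_of_le_ofReal (by positivity)
    (lintegral_treeSqDev_le L I c hω hab hq0 hq1 j)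

end Forest

/-! ### The squared bias of a forest -/

theorem sq_integral_le {Ω : Type*} [MeasurableSpace Ω] {P : Measure Ω} [IsProbabilityMeasure P]
    {f : Ω → ℝ} (hf : MemLp f 2 P) : (∫ ω, f ω ∂P) ^ 2 ≤ ∫ ω, f ω ^ 2 ∂P := by
  have h := variance_nonneg f P
  rw [variance_eq_sub hf] at h
  simp only [Pi.pow_apply] at h
  linarith

section Bias

variable {d K n : ℕ} {a b : Fin K → ℝ} {q : Fin d → ℝ} (L : ℕ)
  (I : Fin K → Finset (Fin n)) (c : Fin n → Fin K)

theorem measurable_forest_covariates (B : Fin K) (x : Fin d → ℝ) (i : Fin n) :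
    Measurable fun X : Fin n → Fin d → ℝ => forest a b q L I B x X i :=
  Measurable.comp (g := fun z : (Fin d → ℝ) × (Fin n → Fin d → ℝ) =>
    forestWeight q L (cube d (a B) (b B)) (I B) z.2 z.1 i) (f := fun X => (x, X))
    (measurable_forestWeight q L (cube d (a B) (b B)) (I B) i) measurable_prodMk_left

theorem measurable_regr (β : Fin d → ℝ) : Measurable (regr β) := by
  unfold regr; fun_prop

theorem integrable_regr_mul_forest (hab : ∀ t, a t < b t) (hq0 : ∀ j, 0 ≤ q j)
    (hq1 : ∑ j, q j = 1) (β : Fin d → ℝ) (B : Fin K) (x : Fin d → ℝ) (i : Fin n) :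
    Integrable (fun X => regr β (X i) * forest a b q L I B x X i) (trainLaw d a b c) := by
  have := isProbabilityMeasure_trainLaw (d := d) hab c
  refine Integrable.of_bound (C := ∑ j, reach a b * |β j|) ?_ ?_
  · exact (((measurable_regr β).comp (measurable_pi_apply i)).mul
      (measurable_forest_covariates L I B x i)).aestronglyMeasurable
  · filter_upwards [ae_trainLaw (d := d) hab c] with X hX
    have h0 := forest_nonneg a b L I hq0 B x X i
    rw [norm_mul, Real.norm_eq_abs, Real.norm_eq_abs, abs_of_nonneg h0]
    refine (mul_le_of_le_one_right (abs_nonneg _) (forest_le_one a b L I hq0 hq1 B x X i)).trans ?_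
    refine (Finset.abs_sum_le_sum_abs _ _).trans (Finset.sum_le_sum fun j _ => ?_)
    rw [abs_mul]
    exact mul_le_mul_of_nonneg_right (abs_le_reach (hX i) j) (abs_nonneg _)

theorem integrable_forest (hab : ∀ t, a t < b t) (hq0 : ∀ j, 0 ≤ q j) (hq1 : ∑ j, q j = 1)
    (B : Fin K) (x : Fin d → ℝ) (i : Fin n) :
    Integrable (fun X => forest a b q L I B x X i) (trainLaw d a b c) := by
  have := isProbabilityMeasure_trainLaw (d := d) hab c
  refine Integrable.of_bound (C := 1)
    (measurable_forest_covariates L I B x i).aestronglyMeasurable (Eventually.of_forall fun X => ?_)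
  rw [Real.norm_eq_abs, abs_of_nonneg (forest_nonneg a b L I hq0 B x X i)]
  exact forest_le_one a b L I hq0 hq1 B x X i

section Noise

variable {ν : Measure ℝ} [IsProbabilityMeasure ν]

instance isProbabilityMeasure_noiseLaw : IsProbabilityMeasure (noiseLaw n ν) := by
  unfold noiseLaw; infer_instance

theorem integrable_noise (hν : Integrable id ν) (i : Fin n) :
    Integrable (fun ε : Fin n → ℝ => ε i) (noiseLaw n ν) :=
  (measurePreserving_eval (fun _ : Fin n => ν) i).integrable_comp_of_integrable hν

theorem integral_noise (hν0 : ∫ y, y ∂ν = 0) (i : Fin n) :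
    ∫ ε, ε i ∂noiseLaw n ν = 0 := by
  rw [noiseLaw, integral_comp_eval (μ := fun _ : Fin n => ν) (f := fun t => t)
    measurable_id.aestronglyMeasurable, hν0]

theorem prediction_eq (W : Learner d K n) (β : Fin d → ℝ) (B : Fin K) (x : Fin d → ℝ)
    (X : Fin n → Fin d → ℝ) (ε : Fin n → ℝ) :
    prediction W β B x X ε =
      ∑ i, (regr β (X i) * W B x X i + W B x X i * ε i) :=
  Finset.sum_congr rfl fun i _ => by ring

theorem integrable_prediction (hab : ∀ t, a t < b t) (hq0 : ∀ j, 0 ≤ q j) (hq1 : ∑ j, q j = 1)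
    (hν : Integrable id ν) (β : Fin d → ℝ) (B : Fin K) (x : Fin d → ℝ) :
    Integrable (fun y => prediction (forest a b q L I) β B x y.1 y.2)
      ((trainLaw d a b c).prod (noiseLaw n ν)) := by
  have := isProbabilityMeasure_trainLaw (d := d) hab c
  simp only [prediction_eq]
  exact integrable_finsetSum _ fun i _ =>
    ((integrable_regr_mul_forest L I c hab hq0 hq1 β B x i).comp_fst _).add
      ((integrable_forest L I c hab hq0 hq1 B x i).mul_prod (integrable_noise hν i))

/-- The noise is centered and independent of the weights. -/
theorem integral_prediction (hab : ∀ t, a t < b t) (hq0 : ∀ j, 0 ≤ q j) (hq1 : ∑ j, q j = 1)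
    (hν : Integrable id ν) (hν0 : ∫ y, y ∂ν = 0) (β : Fin d → ℝ) (B : Fin K) (x : Fin d → ℝ) :
    ∫ y, prediction (forest a b q L I) β B x y.1 y.2 ∂((trainLaw d a b c).prod (noiseLaw n ν)) =
      ∫ X, ∑ i, regr β (X i) * forest a b q L I B x X i ∂trainLaw d a b c := by
  have := isProbabilityMeasure_trainLaw (d := d) hab c
  have h1 := fun i => integrable_regr_mul_forest L I c hab hq0 hq1 β B x i
  have h2 := fun i => (integrable_forest L I c hab hq0 hq1 B x i).mul_prod
    (integrable_noise (n := n) hν i)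
  have h3 : ∀ i, Integrable (fun y : (Fin n → Fin d → ℝ) × (Fin n → ℝ) =>
      regr β (y.1 i) * forest a b q L I B x y.1 i + forest a b q L I B x y.1 i * y.2 i)
      ((trainLaw d a b c).prod (noiseLaw n ν)) := fun i => ((h1 i).comp_fst _).add (h2 i)
  simp only [prediction_eq]
  rw [integral_finsetSum _ fun i _ => h3 i, integral_finsetSum _ fun i _ => h1 i]
  refine Finset.sum_congr rfl fun i _ => ?_
  rw [integral_add ((h1 i).comp_fst _) (h2 i),
    integral_prod_mul (fun X => forest a b q L I B x X i) (fun ε : Fin n → ℝ => ε i),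
    integral_noise hν0, mul_zero, add_zero,
    integral_fun_fst (fun X : Fin n → Fin d → ℝ => regr β (X i) * forest a b q L I B x X i)]
  simp

end Noise

theorem ae_abs_weighted_le [NeZero K] (hab : ∀ t, a t < b t)
    (hq0 : ∀ j, 0 ≤ q j) (hq1 : ∑ j, q j = 1)
    (i : Fin n) (j : Fin d) :
    ∀ᵐ ω ∂(testLaw d a b).prod (trainLaw d a b c),
      |forest a b q L I ω.1.1 ω.1.2 ω.2 i * (ω.2 i j - ω.1.2 j)| ≤ 2 * reach a b := by
  filter_upwards [ae_abs_le_reach hab c] with ω ⟨hx, hX⟩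
  rw [abs_mul, abs_of_nonneg (forest_nonneg a b L I hq0 _ _ _ _)]
  refine (mul_le_of_le_one_left (abs_nonneg _) (forest_le_one a b L I hq0 hq1 _ _ _ _)).trans ?_
  refine (abs_sub _ _).trans ?_
  linarith [hx j, hX i j]

theorem ae_abs_forestDev_le [NeZero K] (hab : ∀ t, a t < b t)
    (hq0 : ∀ j, 0 ≤ q j) (hq1 : ∑ j, q j = 1)
    (j : Fin d) :
    ∀ᵐ ω ∂(testLaw d a b).prod (trainLaw d a b c),
      |forestDev a b q L I j ω| ≤ n * (2 * reach a b) := by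
  filter_upwards [eventually_all.2 fun i => ae_abs_weighted_le L I c hab hq0 hq1 i j] with ω hω
  refine (Finset.abs_sum_le_sum_abs _ _).trans ((Finset.sum_le_sum fun i _ => hω i).trans ?_)
  simp

theorem weighted_regr_sub (β x y : Fin d → ℝ) (w : ℝ) :
    w * (regr β y - regr β x) = ∑ j, β j * (w * (y j - x j)) := by
  rw [regr, regr, ← Finset.sum_sub_distrib, Finset.mul_sum]
  exact Finset.sum_congr rfl fun j _ => by ring

/-- Adding the diagonal completes the cross terms to a square. -/
theorem crossTerm_eq (W : Learner d K n)
    (z : ((Fin d → ℝ) × (Fin K × (Fin d → ℝ))) × (Fin n → Fin d → ℝ)) :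
    crossTerm W z =
      (∑ i, W z.1.2.1 z.1.2.2 z.2 i * (regr z.1.1 (z.2 i) - regr z.1.1 z.1.2.2)) ^ 2 -
      ∑ i, (W z.1.2.1 z.1.2.2 z.2 i * (regr z.1.1 (z.2 i) - regr z.1.1 z.1.2.2)) ^ 2 := by
  have h : ∀ (g : Fin n → ℝ), ∑ i, ∑ i' ∈ Finset.univ.erase i, g i * g i' =
      (∑ i, g i) ^ 2 - ∑ i, g i ^ 2 := fun g => by
    rw [sq, Finset.sum_mul_sum, ← Finset.sum_sub_distrib]
    refine Finset.sum_congr rfl fun i _ => ?_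
    rw [← Finset.add_sum_erase _ (fun i' => g i * g i') (Finset.mem_univ i)]
    ring
  exact h _

theorem sum_weighted_regr_sub (β : Fin d → ℝ)
    (ω : (Fin K × (Fin d → ℝ)) × (Fin n → Fin d → ℝ)) :
    ∑ i, forest a b q L I ω.1.1 ω.1.2 ω.2 i * (regr β (ω.2 i) - regr β ω.1.2) =
      ∑ j, β j * forestDev a b q L I j ω := by
  simp only [weighted_regr_sub, forestDev, Finset.mul_sum]
  exact Finset.sum_comm

variable (S : Finset (Fin d))

theorem memLp_weighted_regr_sub [NeZero K] (hab : ∀ t, a t < b t)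
    (hq0 : ∀ j, 0 ≤ q j) (hq1 : ∑ j, q j = 1)
    (i : Fin n) :
    MemLp (fun z : ((Fin d → ℝ) × (Fin K × (Fin d → ℝ))) × (Fin n → Fin d → ℝ) =>
      forest a b q L I z.1.2.1 z.1.2.2 z.2 i * (regr z.1.1 (z.2 i) - regr z.1.1 z.1.2.2)) 2
      (((betaLaw S).prod (testLaw d a b)).prod (trainLaw d a b c)) := by
  have := isProbabilityMeasure_testLaw (d := d) hab
  have := isProbabilityMeasure_trainLaw (d := d) hab c
  simp only [weighted_regr_sub]
  exact memLp_linearForm S (A := fun j (ω : (Fin K × (Fin d → ℝ)) × (Fin n → Fin d → ℝ)) =>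
      forest a b q L I ω.1.1 ω.1.2 ω.2 i * (ω.2 i j - ω.1.2 j))
    (fun j => (measurable_forest a b q L I i).mul (by fun_prop))
    fun j => ae_abs_weighted_le L I c hab hq0 hq1 i j

theorem memLp_sum_weighted_regr_sub [NeZero K] (hab : ∀ t, a t < b t) (hq0 : ∀ j, 0 ≤ q j)
    (hq1 : ∑ j, q j = 1) :
    MemLp (fun z : ((Fin d → ℝ) × (Fin K × (Fin d → ℝ))) × (Fin n → Fin d → ℝ) =>
      ∑ i, forest a b q L I z.1.2.1 z.1.2.2 z.2 i *
        (regr z.1.1 (z.2 i) - regr z.1.1 z.1.2.2)) 2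
      (((betaLaw S).prod (testLaw d a b)).prod (trainLaw d a b c)) :=
  memLp_finsetSum _ fun i _ => memLp_weighted_regr_sub L I c S hab hq0 hq1 i

theorem integrable_crossTerm [NeZero K] (hab : ∀ t, a t < b t)
    (hq0 : ∀ j, 0 ≤ q j) (hq1 : ∑ j, q j = 1) :
    Integrable (crossTerm (forest a b q L I))
      (((betaLaw S).prod (testLaw d a b)).prod (trainLaw d a b c)) := by
  have h : crossTerm (forest a b q L I) = fun z => _ := funext (crossTerm_eq (forest a b q L I))
  rw [h]
  exact (memLp_sum_weighted_regr_sub L I c S hab hq0 hq1).integrable_sq.sub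
    (integrable_finsetSum _ fun i _ =>
      (memLp_weighted_regr_sub L I c S hab hq0 hq1 i).integrable_sq)

theorem leadingTerm_forest_le [NeZero K] {ω₀ : ℝ} (hω : 0 < ω₀) (hab : ∀ t, b t - a t = ω₀)
    (hq0 : ∀ j, 0 ≤ q j) (hq1 : ∑ j, q j = 1) :
    leadingTerm (forest a b q L I) S a b c ≤
      ∑ j ∈ S, ∫ ω, treeSqDev a b q L I j ω ∂(testLaw d a b).prod (trainLaw d a b c) := by
  have hlt : ∀ t, a t < b t := fun t => by linarith [hab t]
  have := isProbabilityMeasure_testLaw (d := d) hlt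
  have := isProbabilityMeasure_trainLaw (d := d) hlt c
  have hb := fun j => ae_abs_forestDev_le L I c hlt hq0 hq1 j
  calc leadingTerm (forest a b q L I) S a b c
      ≤ ∫ z, (∑ i, forest a b q L I z.1.2.1 z.1.2.2 z.2 i *
          (regr z.1.1 (z.2 i) - regr z.1.1 z.1.2.2)) ^ 2
          ∂(((betaLaw S).prod (testLaw d a b)).prod (trainLaw d a b c)) := by
        refine integral_mono (integrable_crossTerm L I c S hlt hq0 hq1)
          (memLp_sum_weighted_regr_sub L I c S hlt hq0 hq1).integrable_sq fun z => ?_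
        rw [crossTerm_eq]
        exact sub_le_self _ (Finset.sum_nonneg fun i _ => sq_nonneg _)
    _ = ∑ j ∈ S, ∫ ω, forestDev a b q L I j ω ^ 2 ∂(testLaw d a b).prod (trainLaw d a b c) := by
        rw [← integral_linearForm_sq S (measurable_forestDev a b q L I) hb]
        exact integral_congr_ae (Eventually.of_forall fun z =>
          congrArg (· ^ 2) (sum_weighted_regr_sub L I z.1.1 (z.1.2, z.2)))
    _ ≤ _ := Finset.sum_le_sum fun j _ => integral_mono
        (MemLp.of_bound (p := 2) (measurable_forestDev a b q L I j).aestronglyMeasurable _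
          (hb j)).integrable_sq
        (integrable_treeSqDev L I c hω hab hq0 hq1 j) fun ω => forestDev_sq_le a b L I hq0 hq1 j ω

/-- The error of the noiseless prediction is a linear form in the coefficients. -/
theorem sum_regr_mul_forest_sub (hq1 : ∑ j, q j = 1) (β : Fin d → ℝ)
    (ω : (Fin K × (Fin d → ℝ)) × (Fin n → Fin d → ℝ)) :
    ∑ i, regr β (ω.2 i) * forest a b q L I ω.1.1 ω.1.2 ω.2 i - regr β ω.1.2 =
      ∑ j, β j * (forestDev a b q L I j ω -
        ω.1.2 j * forestEmpty a b q L I ω.1.1 ω.1.2 ω.2) := by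
  simp only [mul_sub, Finset.sum_sub_distrib, ← sum_weighted_regr_sub, ← Finset.sum_mul,
    sum_forest a b L I hq1]
  have : ∑ j, β j * (ω.1.2 j * forestEmpty a b q L I ω.1.1 ω.1.2 ω.2) =
      regr β ω.1.2 * forestEmpty a b q L I ω.1.1 ω.1.2 ω.2 := by
    rw [regr, Finset.sum_mul]
    exact Finset.sum_congr rfl fun j _ => by ring
  rw [this, Finset.sum_congr rfl fun i _ => mul_comm _ _]
  ring

theorem ae_abs_forestDev_sub_le [NeZero K] (hab : ∀ t, a t < b t) (hq0 : ∀ j, 0 ≤ q j)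
    (hq1 : ∑ j, q j = 1) (j : Fin d) :
    ∀ᵐ ω ∂(testLaw d a b).prod (trainLaw d a b c),
      |forestDev a b q L I j ω - ω.1.2 j * forestEmpty a b q L I ω.1.1 ω.1.2 ω.2| ≤
        n * (2 * reach a b) + reach a b := by
  filter_upwards [ae_abs_forestDev_le L I c hab hq0 hq1 j, ae_abs_le_reach hab c]
    with ω h1 ⟨h2, _⟩
  refine (abs_sub _ _).trans (add_le_add h1 ?_)
  rw [abs_mul, abs_of_nonneg (forestEmpty_nonneg a b L I hq0 _ _ _)]
  exact (mul_le_of_le_one_right (abs_nonneg _)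
    (forestEmpty_le_one a b L I hq0 hq1 _ _ _)).trans (h2 j)

theorem measurable_forestDev_sub (hq1 : ∑ j, q j = 1) (j : Fin d) :
    Measurable fun ω : (Fin K × (Fin d → ℝ)) × (Fin n → Fin d → ℝ) =>
      forestDev a b q L I j ω - ω.1.2 j * forestEmpty a b q L I ω.1.1 ω.1.2 ω.2 :=
  (measurable_forestDev a b q L I j).sub
    (Measurable.mul (by fun_prop) (measurable_forestEmpty a b L I hq1))

/-- The squared bias is the squared mean, over the training covariates, of a linear form in the
coefficients. -/
theorem sqBiasAt_forest {ν : Measure ℝ} [IsProbabilityMeasure ν] (hab : ∀ t, a t < b t)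
    (hq0 : ∀ j, 0 ≤ q j) (hq1 : ∑ j, q j = 1) (hν : Integrable id ν) (hν0 : ∫ y, y ∂ν = 0)
    (z : (Fin d → ℝ) × (Fin K × (Fin d → ℝ))) :
    sqBiasAt (forest a b q L I) a b c ν z =
      (∫ X, ∑ j, z.1 j * (forestDev a b q L I j (z.2, X) -
        z.2.2 j * forestEmpty a b q L I z.2.1 z.2.2 X) ∂trainLaw d a b c) ^ 2 := by
  have := isProbabilityMeasure_trainLaw (d := d) hab c
  rw [sqBiasAt, integral_prediction L I c hab hq0 hq1 hν hν0]
  congr 1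
  have h : ∫ _ : Fin n → Fin d → ℝ, regr z.1 z.2.2 ∂trainLaw d a b c = regr z.1 z.2.2 := by simp
  rw [← h, ← integral_sub (integrable_finsetSum _ fun i _ =>
    integrable_regr_mul_forest L I c hab hq0 hq1 z.1 z.2.1 z.2.2 i) (integrable_const _)]
  exact integral_congr_ae (Eventually.of_forall fun X =>
    sum_regr_mul_forest_sub L I hq1 z.1 (z.2, X))

theorem integral_forestDev_sub_sq_le [NeZero K] {ω₀ : ℝ} (hω : 0 < ω₀) (hab : ∀ t, b t - a t = ω₀)
    (hq0 : ∀ j, 0 ≤ q j) (hq1 : ∑ j, q j = 1) (j : Fin d) :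
    ∫ ω, (forestDev a b q L I j ω - ω.1.2 j * forestEmpty a b q L I ω.1.1 ω.1.2 ω.2) ^ 2
        ∂(testLaw d a b).prod (trainLaw d a b c) ≤
      ∫ ω, treeSqDev a b q L I j ω ∂(testLaw d a b).prod (trainLaw d a b c) +
      ∫ ω, ω.1.2 j ^ 2 * forestEmpty a b q L I ω.1.1 ω.1.2 ω.2
        ∂(testLaw d a b).prod (trainLaw d a b c) := by
  have hlt : ∀ t, a t < b t := fun t => by linarith [hab t]
  have := isProbabilityMeasure_testLaw (d := d) hlt
  have := isProbabilityMeasure_trainLaw (d := d) hlt c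
  have h1 := integrable_treeSqDev L I c hω hab hq0 hq1 j
  have h2 : Integrable (fun ω : (Fin K × (Fin d → ℝ)) × (Fin n → Fin d → ℝ) =>
      ω.1.2 j ^ 2 * forestEmpty a b q L I ω.1.1 ω.1.2 ω.2)
      ((testLaw d a b).prod (trainLaw d a b c)) := by
    refine Integrable.of_bound (C := reach a b ^ 2) (Measurable.aestronglyMeasurable
      (Measurable.mul (by fun_prop) (measurable_forestEmpty a b L I hq1))) ?_
    filter_upwards [ae_abs_le_reach hlt c] with ω ⟨hx, _⟩
    have h0 := forestEmpty_nonneg a b L I hq0 ω.1.1 ω.1.2 ω.2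
    rw [Real.norm_eq_abs, abs_of_nonneg (mul_nonneg (sq_nonneg _) h0)]
    refine (mul_le_of_le_one_right (sq_nonneg _) (forestEmpty_le_one a b L I hq0 hq1 _ _ _)).trans ?_
    rw [← sq_abs]
    exact pow_le_pow_left₀ (abs_nonneg _) (hx j) 2
  rw [← integral_add h1 h2]
  exact integral_mono (MemLp.of_bound (p := 2)
    (measurable_forestDev_sub L I hq1 j).aestronglyMeasurable _
      (ae_abs_forestDev_sub_le L I c hlt hq0 hq1 j)).integrable_sq (h1.add h2)
    fun ω => forestDev_sub_sq_le a b L I hq0 hq1 j ω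

/-- With `e` the probability of an empty cell, `f x ^ 2 * e` is the square of the linear form in the
coefficients with weights `x j * √e`. -/
theorem emptyTerm_forest [NeZero K] (hab : ∀ t, a t < b t)
    (hq0 : ∀ j, 0 ≤ q j) (hq1 : ∑ j, q j = 1) :
    emptyTerm (forestEmpty a b q L I) S a b c =
      ∑ j ∈ S, ∫ ω, ω.1.2 j ^ 2 * forestEmpty a b q L I ω.1.1 ω.1.2 ω.2
        ∂(testLaw d a b).prod (trainLaw d a b c) := by
  have := isProbabilityMeasure_testLaw (d := d) hab
  have := isProbabilityMeasure_trainLaw (d := d) hab c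
  have hsq : ∀ ω : (Fin K × (Fin d → ℝ)) × (Fin n → Fin d → ℝ),
      √(forestEmpty a b q L I ω.1.1 ω.1.2 ω.2) ^ 2 = forestEmpty a b q L I ω.1.1 ω.1.2 ω.2 :=
    fun ω => Real.sq_sqrt (forestEmpty_nonneg a b L I hq0 _ _ _)
  have h := integral_linearForm_sq S (P := testLaw d a b) (Q := trainLaw d a b c)
    (A := fun j ω => ω.1.2 j * √(forestEmpty a b q L I ω.1.1 ω.1.2 ω.2)) (C := reach a b)
    (fun j => Measurable.mul (by fun_prop) (measurable_forestEmpty a b L I hq1).sqrt) (fun j => by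
      filter_upwards [ae_abs_le_reach hab c] with ω ⟨hx, _⟩
      rw [abs_mul, abs_of_nonneg (Real.sqrt_nonneg _)]
      exact (mul_le_of_le_one_right (abs_nonneg _)
        (Real.sqrt_le_one.2 (forestEmpty_le_one a b L I hq0 hq1 _ _ _))).trans (hx j))
  simp only [mul_pow, hsq] at h
  rw [← h, emptyTerm]
  refine integral_congr_ae (Eventually.of_forall fun z => ?_)
  simp only [← mul_assoc, ← Finset.sum_mul, mul_pow]
  rw [hsq (z.1.2, z.2), regr, Finset.sum_congr rfl fun j _ => mul_comm _ _]

theorem sqBias_forest [NeZero K] {ν : Measure ℝ} [IsProbabilityMeasure ν] {ω₀ : ℝ} (hω : 0 < ω₀)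
    (hab : ∀ t, b t - a t = ω₀) (hq0 : ∀ j, 0 ≤ q j) (hq1 : ∑ j, q j = 1)
    (hν : Integrable id ν) (hν0 : ∫ y, y ∂ν = 0) :
    Integrable (sqBiasAt (forest a b q L I) a b c ν) ((betaLaw S).prod (testLaw d a b)) ∧
    sqBias (forest a b q L I) S a b c ν ≤
      ∑ j ∈ S, ∫ ω, treeSqDev a b q L I j ω ∂(testLaw d a b).prod (trainLaw d a b c) +
      emptyTerm (forestEmpty a b q L I) S a b c := by
  have hlt : ∀ t, a t < b t := fun t => by linarith [hab t]
  have := isProbabilityMeasure_testLaw (d := d) hlt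
  have := isProbabilityMeasure_trainLaw (d := d) hlt c
  set A : Fin d → (Fin K × (Fin d → ℝ)) × (Fin n → Fin d → ℝ) → ℝ := fun j ω =>
    forestDev a b q L I j ω - ω.1.2 j * forestEmpty a b q L I ω.1.1 ω.1.2 ω.2 with hA
  have hmA : ∀ j, Measurable (A j) := measurable_forestDev_sub L I hq1
  have hbA := ae_abs_forestDev_sub_le L I c hlt hq0 hq1
  set H : ((Fin d → ℝ) × (Fin K × (Fin d → ℝ))) × (Fin n → Fin d → ℝ) → ℝ := fun z =>
    ∑ j, z.1.1 j * A j (z.1.2, z.2) with hH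
  have hmH : Measurable H := Finset.measurable_sum _ fun j _ =>
    Measurable.mul (by fun_prop) ((hmA j).comp (by fun_prop))
  have hLH : MemLp H 2 (((betaLaw S).prod (testLaw d a b)).prod (trainLaw d a b c)) :=
    memLp_linearForm S hmA hbA
  have heq : sqBiasAt (forest a b q L I) a b c ν =
      fun z => (∫ X, H (z, X) ∂trainLaw d a b c) ^ 2 :=
    funext fun z => sqBiasAt_forest L I c hlt hq0 hq1 hν hν0 z
  have hle : ∀ᵐ z ∂(betaLaw S).prod (testLaw d a b),
      (∫ X, H (z, X) ∂trainLaw d a b c) ^ 2 ≤ ∫ X, H (z, X) ^ 2 ∂trainLaw d a b c := by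
    filter_upwards [hLH.integrable_sq.prod_right_ae] with z hz
    exact sq_integral_le ((memLp_two_iff_integrable_sq
      (hmH.comp measurable_prodMk_left).aestronglyMeasurable).2 hz)
  have hint : Integrable (fun z => ∫ X, H (z, X) ^ 2 ∂trainLaw d a b c)
      ((betaLaw S).prod (testLaw d a b)) := hLH.integrable_sq.integral_prod_left
  have hint' : Integrable (sqBiasAt (forest a b q L I) a b c ν)
      ((betaLaw S).prod (testLaw d a b)) := by
    rw [heq]
    refine hint.mono' (hmH.stronglyMeasurable.integral_prod_right'.pow 2).aestronglyMeasurable ?_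
    filter_upwards [hle] with z hz
    rwa [Real.norm_eq_abs, abs_of_nonneg (sq_nonneg _)]
  refine ⟨hint', ?_⟩
  calc sqBias (forest a b q L I) S a b c ν
      ≤ ∫ z, ∫ X, H (z, X) ^ 2 ∂trainLaw d a b c ∂(betaLaw S).prod (testLaw d a b) := by
        refine integral_mono_ae hint' hint ?_
        rw [heq]; exact hle
    _ = ∫ z, H z ^ 2 ∂(((betaLaw S).prod (testLaw d a b)).prod (trainLaw d a b c)) :=
        (integral_prod _ hLH.integrable_sq).symm
    _ = ∑ j ∈ S, ∫ ω, A j ω ^ 2 ∂(testLaw d a b).prod (trainLaw d a b c) :=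
        integral_linearForm_sq S hmA hbA
    _ ≤ _ := by
        rw [emptyTerm_forest L I c S hlt hq0 hq1, ← Finset.sum_add_distrib]
        exact Finset.sum_le_sum fun j _ => integral_forestDev_sub_sq_le L I c hω hab hq0 hq1 j

end Bias

/-! ### The probability of an empty cell -/

section Empty

variable {d K n : ℕ} {a b : Fin K → ℝ} {q : Fin d → ℝ} {L : ℕ} {I : Fin K → Finset (Fin n)}
  {c : Fin n → Fin K}

theorem measurableSet_leafCount_eq_zero (θ : SplitTree d L) (R : Box d) (J : Finset (Fin n))
    (x : Fin d → ℝ) : MeasurableSet {X : Fin n → Fin d → ℝ | leafCount L θ R J X x = 0} := by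
  have h : Measurable fun X : Fin n → Fin d → ℝ => ((leafCount L θ R J X x : ℕ) : ℝ) :=
    Measurable.comp (g := fun z : (Fin d → ℝ) × (Fin n → Fin d → ℝ) =>
      ((leafCount L θ R J z.2 z.1 : ℕ) : ℝ)) (f := fun X => (x, X))
      (measurable_leafCount L θ R J) measurable_prodMk_left
  convert h (measurableSet_singleton 0) using 1
  ext X; simp

/-- Already the points of the own cluster of the test point have to miss the cell; each does so
independently with probability `1 - 2 ^ (-L)`. -/
theorem trainLaw_leafCount_eq_zero_le (hab : ∀ t, a t < b t) (θ : SplitTree d L) (t : Fin K)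
    {J : Finset (Fin n)} (hJ : cluster c t ⊆ J) (x : Fin d → ℝ) :
    (trainLaw d a b c).real {X | leafCount L θ (cube d (a t) (b t)) J X x = 0} ≤
      (1 - 1 / 2 ^ L) ^ (cluster c t).card := by
  classical
  have := fun t => isProbabilityMeasure_uniformCube (d := d) (hab t)
  have h2 : (1 : ℝ) / 2 ^ L ≤ 1 := by
    rw [div_le_one (by positivity)]; exact one_le_pow₀ one_le_two
  set A := {y | (leafBox L θ (cube d (a t) (b t)) x).Contains y} with hA
  have hAm : MeasurableSet A := Box.measurableSet_setOf_contains _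
  have hsub : {X | leafCount L θ (cube d (a t) (b t)) J X x = 0} ⊆
      Set.univ.pi fun i => if c i = t then Aᶜ else Set.univ := by
    intro X hX i _
    change X i ∈ if c i = t then Aᶜ else Set.univ
    by_cases hi : c i = t
    · rw [if_pos hi]
      intro hXi
      have h0 : leafCount L θ (cube d (a t) (b t)) J X x = 0 := hX
      rw [leafCount, Finset.card_eq_zero, Finset.filter_eq_empty_iff] at h0
      exact h0 (hJ (by simpa [cluster] using hi)) hXi
    · rw [if_neg hi]; exact Set.mem_univ _
  have hprod : ∀ i, uniformCube d (a (c i)) (b (c i)) (if c i = t then Aᶜ else Set.univ) =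
      if c i = t then ENNReal.ofReal (1 - 1 / 2 ^ L) else 1 := by
    intro i
    split_ifs with hi
    · rw [hi, prob_compl_eq_one_sub hAm, hA, uniformCube_leafBox (hab t),
        ENNReal.ofReal_sub _ (by positivity), ENNReal.ofReal_one]
    · exact measure_univ
  refine ENNReal.toReal_le_of_le_ofReal (pow_nonneg (by linarith) _) ?_
  refine (measure_mono hsub).trans_eq ?_
  rw [trainLaw, Measure.pi_pi, Finset.prod_congr rfl fun i _ => hprod i, Finset.prod_ite,
    Finset.prod_const_one, mul_one, Finset.prod_const, ENNReal.ofReal_pow (by linarith)]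
  rfl

theorem integral_forestEmpty_covariates_le (hab : ∀ t, a t < b t) (hq0 : ∀ j, 0 ≤ q j)
    (hq1 : ∑ j, q j = 1) (hI : ∀ t, cluster c t ⊆ I t) (B : Fin K) (x : Fin d → ℝ) :
    ∫ X, forestEmpty a b q L I B x X ∂trainLaw d a b c ≤
      (1 - 1 / 2 ^ L) ^ (cluster c B).card := by
  have := isProbabilityMeasure_trainLaw (d := d) hab c
  have hind : ∀ θ : SplitTree d L, (fun X : Fin n → Fin d → ℝ =>
      if leafCount L θ (cube d (a B) (b B)) (I B) X x = 0 then (1 : ℝ) else 0) =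
      Set.indicator {X | leafCount L θ (cube d (a B) (b B)) (I B) X x = 0} 1 := fun θ => by
    ext X; simp [Set.indicator]
  have hm := fun θ : SplitTree d L =>
    measurableSet_leafCount_eq_zero θ (cube d (a B) (b B)) (I B) x
  have hint : ∀ θ : SplitTree d L, Integrable (fun X : Fin n → Fin d → ℝ =>
      if leafCount L θ (cube d (a B) (b B)) (I B) X x = 0 then (1 : ℝ) else 0)
      (trainLaw d a b c) := fun θ => by
    rw [hind]; exact (integrable_const (1 : ℝ)).indicator (hm θ)
  calc ∫ X, forestEmpty a b q L I B x X ∂trainLaw d a b c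
      = treeExp q L fun θ => (trainLaw d a b c).real
          {X | leafCount L θ (cube d (a B) (b B)) (I B) X x = 0} := by
        simp only [forestEmpty, emptyProb, treeExp]
        rw [integral_finsetSum _ fun θ _ => (hint θ).const_mul _]
        refine Finset.sum_congr rfl fun θ _ => ?_
        rw [integral_const_mul, hind, integral_indicator_one (hm θ)]
    _ ≤ treeExp q L fun _ => (1 - 1 / 2 ^ L) ^ (cluster c B).card :=
        treeExp_mono hq0 fun θ => trainLaw_leafCount_eq_zero_le hab θ B (hI B) x
    _ = _ := treeExp_const hq1 L _

theorem emptyTerm_forest_le [NeZero K] (hab : ∀ t, a t < b t) (hq0 : ∀ j, 0 ≤ q j)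
    (hq1 : ∑ j, q j = 1) (hI : ∀ t, cluster c t ⊆ I t) (S : Finset (Fin d)) {r : ℝ}
    (hr : ∀ t, reach a b ^ 2 * (1 - 1 / 2 ^ L : ℝ) ^ (cluster c t).card ≤ r) :
    emptyTerm (forestEmpty a b q L I) S a b c ≤ S.card * r := by
  have := isProbabilityMeasure_testLaw (d := d) hab
  have := isProbabilityMeasure_trainLaw (d := d) hab c
  have hint : Integrable (fun ω : (Fin K × (Fin d → ℝ)) × (Fin n → Fin d → ℝ) =>
      forestEmpty a b q L I ω.1.1 ω.1.2 ω.2) ((testLaw d a b).prod (trainLaw d a b c)) := by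
    refine Integrable.of_bound (C := 1) (measurable_forestEmpty a b L I hq1).aestronglyMeasurable
      (Eventually.of_forall fun ω => ?_)
    rw [Real.norm_eq_abs, abs_of_nonneg (forestEmpty_nonneg a b L I hq0 _ _ _)]
    exact forestEmpty_le_one a b L I hq0 hq1 _ _ _
  have hle : ∫ ω, reach a b ^ 2 * forestEmpty a b q L I ω.1.1 ω.1.2 ω.2
      ∂(testLaw d a b).prod (trainLaw d a b c) ≤ r := by
    rw [integral_prod _ (hint.const_mul _)]
    refine (integral_mono (hint.const_mul _).integral_prod_left (integrable_const r)
      fun z => ?_).trans_eq (by simp)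
    simp only [integral_const_mul]
    exact (mul_le_mul_of_nonneg_left
      (integral_forestEmpty_covariates_le hab hq0 hq1 hI z.1 z.2) (sq_nonneg _)).trans (hr z.1)
  rw [emptyTerm_forest L I c S hab hq0 hq1, ← nsmul_eq_mul]
  refine Finset.sum_le_card_nsmul _ _ _ fun j _ => ?_
  refine (integral_mono_of_nonneg (Eventually.of_forall fun ω =>
    mul_nonneg (sq_nonneg _) (forestEmpty_nonneg a b L I hq0 _ _ _)) (hint.const_mul _) ?_).trans hle
  filter_upwards [ae_abs_le_reach hab c] with ω ⟨hx, _⟩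
  refine mul_le_mul_of_nonneg_right ?_ (forestEmpty_nonneg a b L I hq0 _ _ _)
  rw [← sq_abs]
  exact pow_le_pow_left₀ (abs_nonneg _) (hx j) 2

end Empty

/-! ### The rate -/

theorem rate_pos {k p : ℝ} (hk : 2 < k) : 0 < rate k p :=
  Real.rpow_pos_of_pos (by linarith) _

/-- `y ^ log₂ k = k ^ log₂ y`, and the depth is at least `log₂ k`. -/
theorem pow_depth_le_rate {k p r : ℝ} (hk : 2 < k) (hp : 0 ≤ p) (hpr : p ≤ r) (hr : r ≤ 1) :
    (1 - 3 * r / 4) ^ depth k ≤ rate k p := by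
  have h0 : 0 < 1 - 3 * p / 4 := by linarith
  calc (1 - 3 * r / 4) ^ depth k ≤ (1 - 3 * p / 4) ^ depth k :=
        pow_le_pow_left₀ (by linarith) (by linarith) _
    _ = (1 - 3 * p / 4) ^ (depth k : ℝ) := (Real.rpow_natCast _ _).symm
    _ ≤ (1 - 3 * p / 4) ^ Real.logb 2 k :=
        Real.rpow_le_rpow_of_exponent_ge h0 (by linarith) (Nat.le_ceil _)
    _ = rate k p := by
        rw [rate, Real.rpow_def_of_pos h0, Real.rpow_def_of_pos (by linarith : 0 < k)]
        simp only [Real.logb]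
        congr 1; ring

/-- Since `p ≤ 1`, the exponent of the rate is at least `log₂ (1 / 4)`. -/
theorem inv_sq_le_rate {k p : ℝ} (hk : 2 < k) (hp : p ≤ 1) : (k ^ 2)⁻¹ ≤ rate k p := by
  have h : (-2 : ℝ) ≤ Real.logb 2 (1 - 3 * p / 4) := by
    rw [Real.le_logb_iff_rpow_le one_lt_two (by linarith), Real.rpow_neg two_pos.le]
    norm_num
    linarith
  have := Real.rpow_le_rpow_of_exponent_le (by linarith : (1 : ℝ) ≤ k) h
  rwa [Real.rpow_neg (by linarith), Real.rpow_two] at this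

theorem two_pow_depth_le {k : ℝ} (hk : 2 < k) : (2 : ℝ) ^ depth k ≤ 2 * k := by
  have h := Nat.ceil_lt_add_one (Real.logb_nonneg one_lt_two (by linarith : (1 : ℝ) ≤ k))
  rw [← Real.rpow_natCast]
  refine (Real.rpow_le_rpow_of_exponent_le one_le_two h.le).trans_eq ?_
  rw [Real.rpow_add two_pos, Real.rpow_logb two_pos (by norm_num) (by linarith), Real.rpow_one,
    mul_comm]

theorem one_sub_inv_pow_le_exp {k : ℝ} (hk : 2 < k) {N : ℕ} {r : ℝ} (hr : r ≤ N) :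
    (1 - 1 / 2 ^ depth k : ℝ) ^ N ≤ Real.exp (-(r / (2 * k))) := by
  have h2 : (1 : ℝ) / 2 ^ depth k ≤ 1 := by
    rw [div_le_one (by positivity)]; exact one_le_pow₀ one_le_two
  calc (1 - 1 / 2 ^ depth k : ℝ) ^ N ≤ Real.exp (-(1 / 2 ^ depth k)) ^ N :=
        pow_le_pow_left₀ (by linarith) (Real.one_sub_le_exp_neg _) _
    _ = Real.exp (-(N / 2 ^ depth k)) := by rw [← Real.exp_nat_mul]; congr 1; ring
    _ ≤ _ := by
        refine Real.exp_le_exp.2 (neg_le_neg ?_)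
        calc r / (2 * k) ≤ N / (2 * k) := by gcongr
          _ ≤ N / 2 ^ depth k := by gcongr; exact two_pow_depth_le hk

/-- If `k log k = o(n)` then `exp (-n_t / (2 k))` is eventually smaller than any power of `k`. This
holds with any prefactor `M` even when `k` stays bounded, because `k > 2` and the power is arbitrary. -/
theorem eventually_pow_card_le {K : ℕ} [NeZero K] (N : ℕ → Fin K → ℕ) (k : ℕ → ℝ)
    (hk : ∀ n, 2 < k n)
    (hN : ∀ t, Tendsto (fun n : ℕ => (N n t : ℝ) / n) atTop (𝓝 (1 / (K : ℝ))))
    (hkn : Tendsto (fun n : ℕ => k n * Real.log (k n) / n) atTop (𝓝 0)) (M : ℝ) :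
    ∀ᶠ n in atTop, ∀ t, M * (1 - 1 / 2 ^ depth (k n) : ℝ) ^ N n t ≤ (k n ^ 2)⁻¹ := by
  have hK : (0 : ℝ) < K := by exact_mod_cast NeZero.pos K
  -- `k ^ m` exceeds the prefactor, so it suffices to beat `k ^ (m + 2)`
  obtain ⟨m, hm⟩ := pow_unbounded_of_one_lt M (one_lt_two : (1 : ℝ) < 2)
  have h1 : ∀ᶠ n : ℕ in atTop, ∀ t, 1 / (2 * K : ℝ) < (N n t : ℝ) / n :=
    eventually_all.2 fun t => (hN t).eventually_const_lt
      (one_div_lt_one_div_of_lt hK (by linarith))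
  have h2 : ∀ᶠ n : ℕ in atTop, k n * Real.log (k n) / n < 1 / (4 * K * (m + 2)) :=
    hkn.eventually_lt_const (by positivity)
  filter_upwards [h1, h2, eventually_gt_atTop 0] with n h1 h2 hn t
  have hn' : (0 : ℝ) < n := by exact_mod_cast hn
  have hk0 : 0 < k n := by linarith [hk n]
  have hNt : (n : ℝ) / (2 * K) ≤ N n t := by
    have := (lt_div_iff₀ hn').1 (h1 t)
    calc (n : ℝ) / (2 * K) = 1 / (2 * K) * n := by ring
      _ ≤ _ := this.le
  have hlog : (m + 2) * Real.log (k n) ≤ n / (2 * K) / (2 * k n) := by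
    rw [div_lt_div_iff₀ hn' (by positivity)] at h2
    rw [div_div, le_div_iff₀ (by positivity)]
    nlinarith
  have hexp : (1 - 1 / 2 ^ depth (k n) : ℝ) ^ N n t ≤ (k n ^ (m + 2))⁻¹ := by
    refine (one_sub_inv_pow_le_exp (hk n) hNt).trans ?_
    rw [← Real.exp_log (pow_pos hk0 (m + 2)), ← Real.exp_neg, Real.log_pow]
    refine Real.exp_le_exp.2 (neg_le_neg ?_)
    push_cast
    exact hlog
  have hpos : (0 : ℝ) ≤ (1 - 1 / 2 ^ depth (k n) : ℝ) ^ N n t := by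
    refine pow_nonneg (sub_nonneg.2 ?_) _
    rw [div_le_one (by positivity)]; exact one_le_pow₀ one_le_two
  calc M * (1 - 1 / 2 ^ depth (k n) : ℝ) ^ N n t ≤ k n ^ m * (k n ^ (m + 2))⁻¹ := by
        refine mul_le_mul (hm.le.trans ?_) hexp hpos (by positivity)
        exact pow_le_pow_left₀ two_pos.le (hk n).le m
    _ = (k n ^ 2)⁻¹ := by rw [pow_add]; field_simp

/-- The factor `1 / 3` leaves room below `K / 4 ≥ 1 / 2`, which absorbs the contribution of empty
cells for large samples. -/
theorem sum_integral_treeSqDev_le {d K n : ℕ} [NeZero K] {a b : Fin K → ℝ} {q : Fin d → ℝ}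
    {S : Finset (Fin d)} {ω₀ k p : ℝ} (hω : 0 < ω₀) (hab : ∀ t, b t - a t = ω₀)
    (hq0 : ∀ j, 0 ≤ q j) (hq1 : ∑ j, q j = 1) (hk : 2 < k) (hp : 0 ≤ p)
    (hpq : ∀ j ∈ S, p ≤ q j) (I : Fin K → Finset (Fin n)) (c : Fin n → Fin K) :
    ∑ j ∈ S, ∫ ω, treeSqDev a b q (depth k) I j ω ∂(testLaw d a b).prod (trainLaw d a b c) ≤
      1 / 3 * (ω₀ ^ 2 * S.card * rate k p) := by
  have hle : ∀ j, q j ≤ 1 := fun j =>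
    (Finset.single_le_sum (fun i _ => hq0 i) (Finset.mem_univ j)).trans_eq hq1
  calc _ ≤ S.card • (ω₀ ^ 2 / 3 * rate k p) := by
        refine Finset.sum_le_card_nsmul _ _ _ fun j hj => ?_
        refine (integral_treeSqDev_le _ I c hω hab hq0 hq1 j (by linarith [hle j])).trans ?_
        exact mul_le_mul_of_nonneg_left (pow_depth_le_rate hk hp (hpq j hj) (hle j))
          (by positivity)
    _ = _ := by rw [nsmul_eq_mul]; ring

theorem ensemble_eq_forest {d K n : ℕ} (a b : Fin K → ℝ) (c : Fin n → Fin K) (q : Fin d → ℝ)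
    (k : ℝ) : ensemble a b c q k = forest a b q (depth k) (cluster c) := by
  funext B x X i; simp [ensemble, forest]

theorem ensembleEmptyProb_eq {d K n : ℕ} (a b : Fin K → ℝ) (c : Fin n → Fin K) (q : Fin d → ℝ)
    (k : ℝ) : ensembleEmptyProb a b c q k = forestEmpty a b q (depth k) (cluster c) := by
  funext B x X; simp [ensembleEmptyProb, forestEmpty]

theorem merged_eq_forest {d K n : ℕ} (a b : Fin K → ℝ) (q : Fin d → ℝ) (k : ℝ) :
    (merged a b q k : Learner d K n) = forest a b q (depth k) fun _ => Finset.univ := rfl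

theorem mergedEmptyProb_eq {d K n : ℕ} (a b : Fin K → ℝ) (q : Fin d → ℝ) (k : ℝ) :
    (mergedEmptyProb (n := n) a b q k) = forestEmpty a b q (depth k) fun _ => Finset.univ := rfl

theorem four_rpow_logb (K : ℝ) (hK : 0 < K) : (4 : ℝ) ^ Real.logb 2 K = K ^ 2 := by
  rw [show (4 : ℝ) = 2 ^ (2 : ℝ) by norm_num, ← Real.rpow_mul two_pos.le, mul_comm,
    Real.rpow_mul two_pos.le, Real.rpow_logb two_pos (by norm_num) hK, Real.rpow_two]

theorem mergedBound_eq {K : ℕ} (hK : 0 < K) (s : ℕ) (ω k p : ℝ) :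
    mergedBound K s ω k p = (K : ℝ) ^ 2 / 4 * (ω ^ 2 * s * rate k p) := by
  rw [mergedBound, Real.rpow_sub (by norm_num), four_rpow_logb _ (by exact_mod_cast hK),
    Real.rpow_one]
  ring

theorem ensembleBound_eq (K s : ℕ) (ω k p : ℝ) :
    ensembleBound K s ω k p = (K : ℝ) / 4 * (ω ^ 2 * s * rate k p) := by
  rw [ensembleBound]; ring

end CenteredForest

theorem theorem5
    {d K r : ℕ} (hr : 1 ≤ r) (hK : K = 2 ^ r)
    -- uniform clusters of common width
    (a b : Fin K → ℝ) (ω : ℝ) (hω : 0 < ω) (hab : ∀ t, b t - a t = ω)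
    -- strong features
    (S : Finset (Fin d)) (hS : S.Nonempty)
    -- centered noise with finite variance
    (ν : Measure ℝ) [IsProbabilityMeasure ν] (hν : MemLp id 2 ν) (hν0 : ∫ y, y ∂ν = 0)
    -- for every sample size: cluster assignment, number of leaves, selection probabilities
    (c : (n : ℕ) → Fin n → Fin K)
    (k : ℕ → ℝ) (hk : ∀ n, 2 < k n)
    (q : ℕ → Fin d → ℝ) (hq0 : ∀ n j, 0 ≤ q n j) (hq1 : ∀ n, ∑ j, q n j = 1)
    -- the smallest selection probability of a strong feature
    (p : ℕ → ℝ) (hp : ∀ n, p n = S.inf' hS (q n)) :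
    -- the expectations below exist
    (∀ n, ∀ W ∈ ({CenteredForest.ensemble a b (c n) (q n) (k n),
          CenteredForest.merged a b (q n) (k n)} : Set (CenteredForest.Learner d K n)),
        (∀ β B x, Integrable (fun y => CenteredForest.prediction W β B x y.1 y.2)
          ((CenteredForest.trainLaw d a b (c n)).prod (CenteredForest.noiseLaw n ν))) ∧
        Integrable (CenteredForest.sqBiasAt W a b (c n) ν)
          ((CenteredForest.betaLaw S).prod (CenteredForest.testLaw d a b)) ∧
        Integrable (CenteredForest.crossTerm W)
          (((CenteredForest.betaLaw S).prod (CenteredForest.testLaw d a b)).prod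
            (CenteredForest.trainLaw d a b (c n)))) ∧
    -- (i) Ensemble: leading term of the squared bias, and the squared bias itself
    (∀ n, CenteredForest.leadingTerm (CenteredForest.ensemble a b (c n) (q n) (k n)) S a b (c n)
          ≤ CenteredForest.ensembleBound K S.card ω (k n) (p n) ∧
        CenteredForest.sqBias (CenteredForest.ensemble a b (c n) (q n) (k n)) S a b (c n) ν
          ≤ CenteredForest.ensembleBound K S.card ω (k n) (p n) +
            CenteredForest.emptyTerm
              (CenteredForest.ensembleEmptyProb a b (c n) (q n) (k n)) S a b (c n)) ∧
    -- (ii) Merged: leading term of the squared bias, and the squared bias itself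
    (∀ n, CenteredForest.leadingTerm (CenteredForest.merged a b (q n) (k n)) S a b (c n)
          ≤ CenteredForest.mergedBound K S.card ω (k n) (p n) ∧
        CenteredForest.sqBias (CenteredForest.merged a b (q n) (k n)) S a b (c n) ν
          ≤ CenteredForest.mergedBound K S.card ω (k n) (p n) +
            CenteredForest.emptyTerm
              (CenteredForest.mergedEmptyProb a b (q n) (k n)) S a b (c n)) ∧
    -- with balanced clusters and leaves that are not too small, the bounds hold for the squared
    -- bias as they stand
    ((∀ t, Tendsto (fun n : ℕ => ((CenteredForest.cluster (c n) t).card : ℝ) / n) atTop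
          (𝓝 (1 / (K : ℝ)))) →
      Tendsto (fun n : ℕ => k n * Real.log (k n) / n) atTop (𝓝 0) →
      ∀ᶠ n in atTop,
        CenteredForest.sqBias (CenteredForest.ensemble a b (c n) (q n) (k n)) S a b (c n) ν
          ≤ CenteredForest.ensembleBound K S.card ω (k n) (p n) ∧
        CenteredForest.sqBias (CenteredForest.merged a b (q n) (k n)) S a b (c n) ν
          ≤ CenteredForest.mergedBound K S.card ω (k n) (p n)) ∧
    -- comparison of the two bounds
    (∀ n, CenteredForest.ensembleBound K S.card ω (k n) (p n)
          < CenteredForest.mergedBound K S.card ω (k n) (p n) ∧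
        CenteredForest.mergedBound K S.card ω (k n) (p n)
          = (4 : ℝ) ^ Real.logb 2 K / K *
            CenteredForest.ensembleBound K S.card ω (k n) (p n) ∧
        (4 : ℝ) ^ Real.logb 2 K / K = 2 ^ r) := by
  have : NeZero K := ⟨by rw [hK]; positivity⟩
  have hlt : ∀ t, a t < b t := fun t => by linarith [hab t]
  have hK2 : (2 : ℝ) ≤ K := by
    have : 2 ^ 1 ≤ 2 ^ r := Nat.pow_le_pow_right two_pos hr
    rw [hK]; exact_mod_cast this
  have hνi : Integrable id ν := hν.integrable one_le_two
  have hp0 : ∀ n, 0 ≤ p n := fun n => by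
    rw [hp]; exact (Finset.le_inf'_iff _ _).2 fun j _ => hq0 n j
  have hpq : ∀ n, ∀ j ∈ S, p n ≤ q n j := fun n j hj => by
    rw [hp]; exact Finset.inf'_le _ hj
  have hp1 : ∀ n, p n ≤ 1 := fun n => by
    obtain ⟨j, hj⟩ := hS
    exact (hpq n j hj).trans
      ((Finset.single_le_sum (fun i _ => hq0 n i) (Finset.mem_univ j)).trans_eq (hq1 n))
  have hpos : ∀ n, 0 < ω ^ 2 * S.card * CenteredForest.rate (k n) (p n) := fun n => by
    have h1 := CenteredForest.rate_pos (p := p n) (hk n)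
    have h2 : (0 : ℝ) < S.card := by exact_mod_cast hS.card_pos
    positivity
  -- this is sharp for two clusters
  have hE : ∀ n, 1 / 2 * (ω ^ 2 * S.card * CenteredForest.rate (k n) (p n)) ≤
      CenteredForest.ensembleBound K S.card ω (k n) (p n) := fun n => by
    rw [CenteredForest.ensembleBound_eq]
    exact mul_le_mul_of_nonneg_right (by linarith) (hpos n).le
  have hEM : ∀ n, CenteredForest.ensembleBound K S.card ω (k n) (p n) <
      CenteredForest.mergedBound K S.card ω (k n) (p n) := fun n => by
    rw [CenteredForest.ensembleBound_eq, CenteredForest.mergedBound_eq (NeZero.pos K)]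
    exact mul_lt_mul_of_pos_right (by nlinarith) (hpos n)
  -- both learners are instances of `CenteredForest.forest`, so the estimates are for arbitrary `I`
  have hsum := fun n (I : Fin K → Finset (Fin n)) => CenteredForest.sum_integral_treeSqDev_le
    hω hab (hq0 n) (hq1 n) (hk n) (hp0 n) (hpq n) I (c n)
  have hlead := fun n (I : Fin K → Finset (Fin n)) =>
    (CenteredForest.leadingTerm_forest_le (CenteredForest.depth (k n)) I (c n) S hω hab
      (hq0 n) (hq1 n)).trans (hsum n I)
  have hbias := fun n (I : Fin K → Finset (Fin n)) =>
    CenteredForest.sqBias_forest (CenteredForest.depth (k n)) I (c n) S hω hab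
      (hq0 n) (hq1 n) hνi hν0
  simp only [CenteredForest.ensemble_eq_forest, CenteredForest.merged_eq_forest,
    CenteredForest.ensembleEmptyProb_eq, CenteredForest.mergedEmptyProb_eq]
  refine ⟨?_, fun n => ⟨?_, ?_⟩, fun n => ⟨?_, ?_⟩, ?_, fun n => ⟨hEM n, ?_, ?_⟩⟩
  · intro n W hW
    have hW' : ∃ I : Fin K → Finset (Fin n),
        W = CenteredForest.forest a b (q n) (CenteredForest.depth (k n)) I := by
      rcases hW with rfl | rfl
      exacts [⟨_, rfl⟩, ⟨_, rfl⟩]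
    obtain ⟨I, rfl⟩ := hW'
    exact ⟨CenteredForest.integrable_prediction _ I (c n) hlt (hq0 n) (hq1 n) hνi, (hbias n I).1,
      CenteredForest.integrable_crossTerm _ I (c n) S hlt (hq0 n) (hq1 n)⟩
  · linarith [hlead n (CenteredForest.cluster (c n)), hE n, hpos n]
  · linarith [(hbias n (CenteredForest.cluster (c n))).2,
      hsum n (CenteredForest.cluster (c n)), hE n, hpos n]
  · linarith [hlead n fun _ => Finset.univ, hE n, hEM n, hpos n]
  · linarith [(hbias n fun _ => Finset.univ).2, hsum n fun _ => Finset.univ, hE n, hEM n, hpos n]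
  · intro hbal hkn
    filter_upwards [CenteredForest.eventually_pow_card_le
      (fun n t => (CenteredForest.cluster (c n) t).card) k hk hbal hkn
      (6 * CenteredForest.reach a b ^ 2 / ω ^ 2)] with n hn
    -- the gap between `1 / 3` and `1 / 2`
    have hempty : ∀ I : Fin K → Finset (Fin n), (∀ t, CenteredForest.cluster (c n) t ⊆ I t) →
        CenteredForest.emptyTerm (CenteredForest.forestEmpty a b (q n)
          (CenteredForest.depth (k n)) I) S a b (c n) ≤
        1 / 6 * (ω ^ 2 * S.card * CenteredForest.rate (k n) (p n)) := fun I hI => by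
      refine (CenteredForest.emptyTerm_forest_le
        (r := 1 / 6 * (ω ^ 2 * CenteredForest.rate (k n) (p n)))
        hlt (hq0 n) (hq1 n) hI S fun t => ?_).trans_eq (by ring)
      have h := (hn t).trans (CenteredForest.inv_sq_le_rate (hk n) (hp1 n))
      rw [div_mul_eq_mul_div, div_le_iff₀ (by positivity)] at h
      linarith
    constructor
    · linarith [(hbias n (CenteredForest.cluster (c n))).2,
        hsum n (CenteredForest.cluster (c n)), hE n,
        hempty (CenteredForest.cluster (c n)) fun t => subset_rfl]
    · linarith [(hbias n fun _ => Finset.univ).2, hsum n fun _ => Finset.univ, hE n, hEM n,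
        hempty (fun _ => Finset.univ) fun t => Finset.subset_univ _]
  · rw [CenteredForest.four_rpow_logb _ (by linarith), CenteredForest.ensembleBound_eq,
      CenteredForest.mergedBound_eq (NeZero.pos K)]
    have : (K : ℝ) ≠ 0 := by linarith
    field_simp
  · rw [CenteredForest.four_rpow_logb _ (by linarith), sq, mul_div_assoc,
      div_self (by linarith), mul_one, hK]
    push_cast
    rfl
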